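/- Let $N,m\ge 1$ and let $M_N$ be the space of real $N\times N$ matrices. For $p>0$ and $X\in M_N$ with singular values $\sigma_1,\dots,\sigma_N$ put $\|X\|_{S_p}=\big(\sum_{i=1}^N\sigma_i^p\big)^{1/p}$, and for an integer $s\ge 1$ put $\rho_s(X)_{S_p}=\inf\{\|X-Y\|_{S_p} : Y\in M_N,\ \operatorname{rank}(Y)\le s\}$. For a linear map $\mathcal A:M_N\to\mathbb R^m$ and an integer $k\ge 1$ let $\alpha_k,\beta_k\ge 0$ be the best (i.e. largest, respectively smallest) constants such that $$\alpha_k\|Z\|_{S_2}\le\|\mathcal A Z\|_{\ell_2}\le\beta_k\|Z\|_{S_2}\qquad\text{for all } Z\in M_N \text{ with } \operatorname{rank}(Z)\le k,$$ and, when $\alpha_k>0$, let $\gamma_k=\beta_k^2/\alpha_k^2$. **Theorem.** There are constants $C_1,C_2,D_1,D_2$, depending only on $p$, $\gamma_{2t}$ and the ratio $s/t$, such that the following holds. Let $0<p\le 1$, let $t\ge s\ge 1$ be integers, and let $\mathcal A:M_N\to\mathbb R^m$ be a linear map with $\alpha_{2t}>0$ and $$\gamma_{2t}-1<4(\sqrt2-1)\Big(\frac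 ts\Big)^{1/p-1/2}.$$ Let $\theta\ge 0$, $X\in M_N$, and let $y\in\mathbb R^m$ satisfy $\|\mathcal A X-y\|_{\ell_2}\le\beta_{2s}\theta$. Then every solution $X^*$ of the problem $$\text{minimize } \|Z\|_{S_p}\quad\text{subject to}\quad \|\mathcal A Z-y\|_{\ell_2}\le\beta_{2s}\,\theta$$ satisfies $$\|X-X^*\|_{S_p}\le C_1\,\rho_s(X)_{S_p}+D_1\,s^{1/p-1/2}\,\theta,\qquad \|X-X^*\|_{S_2}\le C_2\,\frac{\rho_s(X)_{S_p}}{t^{1/p-1/2}}+D_2\,\theta .$$ -/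

import Mathlib

noncomputable section

namespace LowRank

/-- The Schatten `p`-(quasi-)norm of a real `N × N` matrix, `p > 0`: the `ℓ_p`-(quasi-)norm of the
vector of its `N` singular values (those of the operator it induces on Euclidean space). -/
def schattenNorm {N : ℕ} (p : ℝ) (X : Matrix (Fin N) (Fin N) ℝ) : ℝ :=
  (∑ i : Fin N, (Matrix.toEuclideanLin X).singularValues (i : ℕ) ^ p) ^ (1 / p)

/-- The error of best approximation by matrices of rank at most `s` in the Schatten
`p`-(quasi-)norm. -/
def rankError {N : ℕ} (p : ℝ) (s : ℕ) (X : Matrix (Fin N) (Fin N) ℝ) : ℝ :=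
  sInf {r : ℝ | ∃ Y : Matrix (Fin N) (Fin N) ℝ, Y.rank ≤ s ∧ r = schattenNorm p (X - Y)}

variable {N m : ℕ}

/-- The best (largest) constant `α_k ≥ 0` with `α_k ‖Z‖_{S_2} ≤ ‖A Z‖` whenever `rank Z ≤ k`. -/
def lowerRIP (A : Matrix (Fin N) (Fin N) ℝ →ₗ[ℝ] EuclideanSpace ℝ (Fin m)) (k : ℕ) : ℝ :=
  sSup {a : ℝ | 0 ≤ a ∧ ∀ Z : Matrix (Fin N) (Fin N) ℝ, Z.rank ≤ k → a * schattenNorm 2 Z ≤ ‖A Z‖}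

/-- The best (smallest) constant `β_k ≥ 0` with `‖A Z‖ ≤ β_k ‖Z‖_{S_2}` whenever `rank Z ≤ k`. -/
def upperRIP (A : Matrix (Fin N) (Fin N) ℝ →ₗ[ℝ] EuclideanSpace ℝ (Fin m)) (k : ℕ) : ℝ :=
  sInf {b : ℝ | 0 ≤ b ∧ ∀ Z : Matrix (Fin N) (Fin N) ℝ, Z.rank ≤ k → ‖A Z‖ ≤ b * schattenNorm 2 Z}

/-- The ratio `γ_k = β_k² / α_k²`; meaningful only when `α_k > 0`. -/
def ratioRIP (A : Matrix (Fin N) (Fin N) ℝ →ₗ[ℝ] EuclideanSpace ℝ (Fin m)) (k : ℕ) : ℝ :=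
  upperRIP A k ^ 2 / lowerRIP A k ^ 2

/-- `W` solves: minimize `‖Z‖_{S_p}` subject to `‖A Z - y‖ ≤ ε`. -/
def IsSchattenMinimizer (p : ℝ) (A : Matrix (Fin N) (Fin N) ℝ →ₗ[ℝ] EuclideanSpace ℝ (Fin m))
    (y : EuclideanSpace ℝ (Fin m)) (ε : ℝ) (W : Matrix (Fin N) (Fin N) ℝ) : Prop :=
  ‖A W - y‖ ≤ ε ∧
    ∀ Z : Matrix (Fin N) (Fin N) ℝ, ‖A Z - y‖ ≤ ε → schattenNorm p W ≤ schattenNorm p Z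

end LowRank

end

/-!
The proof transfers the vector argument for `ℓ_p` minimization to singular values by means of the
concave Mirsky inequality
`∑ |σᵢ(A) ^ p - σᵢ(B) ^ p| ≤ ∑ σᵢ(A - B) ^ p` (`sum_abs_concave_singularValues_sub_le`, for any
concave increasing `f` with `f 0 = 0`). By the singular value decomposition of `A - B` it is enough
to treat a rank one perturbation `c u vᵀ`. There the singular values of the two operators interlace
(`singularValues_succ_le_of_rankOne`), so that the intervals between corresponding singular values
are disjoint, and their total length is at most `c`
(`sum_abs_singularValues_sub_le_of_rankOne`): the self-adjoint dilation, with eigenvalues `±σᵢ`,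
is changed by a difference of two positive rank one operators, each of which moves all eigenvalues
in one direction, and the sum of the displacements is a trace. A concave function then increases
over the union of the intervals by at most `f c` (`sum_concave_sub_le`).

Applied to `X` and the error `V = X - X*`, whose difference is the minimizer, the inequality
yields `∑_{i ≥ s} σᵢ(V) ^ p ≤ ∑_{i < s} σᵢ(V) ^ p + 2 ρ ^ p` with `ρ` the error of best rank `s`
approximation (`sum_tail_error_le`); applied to `X` and a matrix of rank at most `s`, it bounds the
tail of `X` by `ρ`.

On the other side, cut the singular value decomposition of `V` into a leading block of rank `s`
followed by blocks of rank `t`. The images of two different blocks are almost orthogonal by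
polarization, which bounds the leading block by the Euclidean norms of the blocks from the third
on and by `‖A V‖ ≤ 2 β θ` (`block_norm_le`). Since the singular values decrease, the former are at
most `t ^ (1/2 - 1/p)` times the `p`-norm of the tail (`sum_sqrt_sum_block_le`). The resulting
factor in front of the tail is `contraction`, and it is less than one exactly under the hypothesis
on `γ`; combined with the cone condition this gives both estimates (`recovery_of_blocks`).
-/

/-! ### Perturbation of quadratic forms and the singular value decomposition -/

namespace LowRank

open Module InnerProductSpace
open scoped RealInnerProductSpace

section Forms

variable {K : Type*} [NormedAddCommGroup K] [InnerProductSpace ℝ K]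

theorem exists_ne_zero_inner_eq_zero [FiniteDimensional ℝ K] {κ : Type*} [Fintype κ] (w : κ → K)
    (h : Fintype.card κ < finrank ℝ K) : ∃ x : K, x ≠ 0 ∧ ∀ k, ⟪w k, x⟫ = 0 := by
  let φ : K →ₗ[ℝ] κ → ℝ := LinearMap.pi fun k => (innerSL ℝ (w k) : K →ₗ[ℝ] ℝ)
  have hφ : LinearMap.ker φ ≠ ⊥ := LinearMap.ker_ne_bot_of_finrank_lt (by simpa using h)
  obtain ⟨x, hx, hx0⟩ := (Submodule.ne_bot_iff _).1 hφ
  refine ⟨x, hx0, fun k => ?_⟩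
  have := congrFun (LinearMap.mem_ker.1 hx) k
  simpa [φ] using this

variable {ι : Type*} [Fintype ι]

theorem sum_mul_inner_sq_le (e : OrthonormalBasis ι ℝ K) {a : ι → ℝ} {c : ℝ} {x : K}
    (h : ∀ j, ⟪e j, x⟫ = 0 ∨ a j ≤ c) : ∑ j, a j * ⟪e j, x⟫ ^ 2 ≤ c * ‖x‖ ^ 2 := by
  rw [← e.sum_sq_inner_right x, Finset.mul_sum]
  refine Finset.sum_le_sum fun j _ => ?_
  rcases h j with h | h
  · simp [h]
  · gcongr

theorem le_sum_mul_inner_sq (e : OrthonormalBasis ι ℝ K) {a : ι → ℝ} {c : ℝ} {x : K}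
    (h : ∀ j, ⟪e j, x⟫ = 0 ∨ c ≤ a j) : c * ‖x‖ ^ 2 ≤ ∑ j, a j * ⟪e j, x⟫ ^ 2 := by
  rw [← e.sum_sq_inner_right x, Finset.mul_sum]
  refine Finset.sum_le_sum fun j _ => ?_
  rcases h j with h | h
  · simp [h]
  · gcongr

/-- Weyl's monotonicity principle, for quadratic forms given in diagonal form: a unit vector
orthogonal to all `e j` with `j > i` and to all `f j` with `j < i` separates `a i` from `b i`. -/
theorem eigenvalue_le_of_form_le [FiniteDimensional ℝ K] [LinearOrder ι] (e f : OrthonormalBasis ι ℝ K) {a b : ι → ℝ}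
    (ha : Antitone a) (hb : Antitone b)
    (h : ∀ x, ∑ j, a j * ⟪e j, x⟫ ^ 2 ≤ ∑ j, b j * ⟪f j, x⟫ ^ 2) (i : ι) : a i ≤ b i := by
  obtain ⟨x, hx0, hx⟩ := exists_ne_zero_inner_eq_zero
    (fun j : {j // j ≠ i} => if j.1 < i then f j else e j) (by
      rw [finrank_eq_card_basis e.toBasis]
      exact Fintype.card_subtype_lt (x := i) (by simp))
  have h1 : a i * ‖x‖ ^ 2 ≤ ∑ j, a j * ⟪e j, x⟫ ^ 2 := le_sum_mul_inner_sq e fun j => by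
    rcases le_or_gt j i with hj | hj
    · exact Or.inr (ha hj)
    · have := hx ⟨j, hj.ne'⟩
      rw [if_neg hj.not_gt] at this
      exact Or.inl this
  have h2 : ∑ j, b j * ⟪f j, x⟫ ^ 2 ≤ b i * ‖x‖ ^ 2 := sum_mul_inner_sq_le f fun j => by
    rcases le_or_gt i j with hj | hj
    · exact Or.inr (hb hj)
    · have := hx ⟨j, hj.ne⟩
      rw [if_pos hj] at this
      exact Or.inl this
  have : 0 < ‖x‖ ^ 2 := by positivity
  exact le_of_mul_le_mul_right ((h1.trans (h x)).trans h2) this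

theorem sum_form_orthonormalBasis {κ : Type*} [Fintype κ] (e : OrthonormalBasis ι ℝ K) (a : ι → ℝ)
    (g : OrthonormalBasis κ ℝ K) : ∑ k, ∑ j, a j * ⟪e j, g k⟫ ^ 2 = ∑ j, a j := by
  rw [Finset.sum_comm]
  refine Finset.sum_congr rfl fun j _ => ?_
  rw [← Finset.mul_sum, g.sum_sq_inner_left, e.norm_eq_one]
  simp

/-- A diagonal form plus a rank one square can be diagonalized again, with sorted eigenvalues. -/
theorem exists_diagonalization_add_sq [FiniteDimensional ℝ K] [LinearOrder ι] (e : OrthonormalBasis ι ℝ K) (a : ι → ℝ)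
    (w : K) : ∃ (g : OrthonormalBasis ι ℝ K) (m : ι → ℝ), Antitone m ∧
      ∀ x, ∑ j, m j * ⟪g j, x⟫ ^ 2 = ∑ j, a j * ⟪e j, x⟫ ^ 2 + ⟪w, x⟫ ^ 2 := by
  let S : K →ₗ[ℝ] K := (∑ j, a j • (rankOne ℝ (e j) (e j) : K →L[ℝ] K) + rankOne ℝ w w : K →L[ℝ] K)
  have hSapp : ∀ x, S x = ∑ j, (a j * ⟪e j, x⟫) • e j + ⟪w, x⟫ • w := fun x => by
    simp [S, smul_smul]
  have hS : S.IsSymmetric := fun x y => by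
    simp only [hSapp, inner_add_left, inner_add_right, sum_inner, inner_sum, inner_smul_left,
      inner_smul_right]
    simp only [real_inner_comm]
    congr 1
    · refine Finset.sum_congr rfl fun j _ => ?_
      simp; ring
    · simp; ring
  have hn : finrank ℝ K = Fintype.card ι := finrank_eq_card_basis e.toBasis
  let o : Fin (Fintype.card ι) ≃o ι := Fintype.orderIsoFinOfCardEq ι rfl
  refine ⟨(hS.eigenvectorBasis hn).reindex o.toEquiv, fun j => hS.eigenvalues hn (o.symm j),
    fun j k hjk => hS.eigenvalues_antitone hn (o.symm.monotone hjk), fun x => ?_⟩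
  have h1 : ⟪x, S x⟫ = ∑ j, a j * ⟪e j, x⟫ ^ 2 + ⟪w, x⟫ ^ 2 := by
    rw [hSapp, inner_add_right, inner_sum, inner_smul_right, real_inner_comm x w, sq]
    congr 1
    refine Finset.sum_congr rfl fun j _ => ?_
    rw [inner_smul_right, real_inner_comm x (e j)]
    ring
  rw [← h1, ← (hS.eigenvectorBasis hn).sum_inner_mul_inner x (S x),
    ← Equiv.sum_comp o.toEquiv]
  refine Finset.sum_congr rfl fun j _ => ?_
  have := hS.eigenvectorBasis_apply_self_apply hn x j
  rw [OrthonormalBasis.repr_apply_apply, OrthonormalBasis.repr_apply_apply] at this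
  rw [this]
  simp [real_inner_comm]
  ring

/-- The total displacement of the eigenvalues under a rank two update `w wᵀ - z zᵀ` is at most
`‖w‖² + ‖z‖²`: both forms lie below their common upper bound, so that the absolute values
disappear and only traces remain. -/
theorem sum_abs_eigenvalue_sub_le [FiniteDimensional ℝ K] [LinearOrder ι] (e f : OrthonormalBasis ι ℝ K) {a b : ι → ℝ}
    (ha : Antitone a) (hb : Antitone b) (w z : K)
    (h : ∀ x, ∑ j, a j * ⟪e j, x⟫ ^ 2 + ⟪w, x⟫ ^ 2 = ∑ j, b j * ⟪f j, x⟫ ^ 2 + ⟪z, x⟫ ^ 2) :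
    ∑ j, |a j - b j| ≤ ‖w‖ ^ 2 + ‖z‖ ^ 2 := by
  obtain ⟨g, m, hm, hg⟩ := exists_diagonalization_add_sq e a w
  have ham : ∀ j, a j ≤ m j := eigenvalue_le_of_form_le e g ha hm fun x => by
    rw [hg]; nlinarith [sq_nonneg ⟪w, x⟫]
  have hbm : ∀ j, b j ≤ m j := eigenvalue_le_of_form_le f g hb hm fun x => by
    rw [hg, h]; nlinarith [sq_nonneg ⟪z, x⟫]
  have t1 : ∑ j, m j = ∑ j, a j + ‖w‖ ^ 2 := by
    rw [← sum_form_orthonormalBasis g m e, ← sum_form_orthonormalBasis e a e,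
      ← e.sum_sq_inner_left w, ← Finset.sum_add_distrib]
    exact Finset.sum_congr rfl fun k _ => hg _
  have t2 : ∑ j, m j = ∑ j, b j + ‖z‖ ^ 2 := by
    rw [← sum_form_orthonormalBasis g m e, ← sum_form_orthonormalBasis f b e,
      ← e.sum_sq_inner_left z, ← Finset.sum_add_distrib]
    exact Finset.sum_congr rfl fun k _ => (hg _).trans (h _)
  calc ∑ j, |a j - b j| ≤ ∑ j, ((m j - a j) + (m j - b j)) :=
        Finset.sum_le_sum fun j _ => by
          rw [abs_le]; constructor <;> linarith [ham j, hbm j]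
    _ = ‖w‖ ^ 2 + ‖z‖ ^ 2 := by
        rw [Finset.sum_add_distrib, Finset.sum_sub_distrib, Finset.sum_sub_distrib]
        linarith

end Forms

section SVD

variable {E : Type*} [NormedAddCommGroup E] [InnerProductSpace ℝ E]
variable {n : ℕ}

/-- The singular value decomposition. -/
theorem exists_svd [FiniteDimensional ℝ E] (hn : finrank ℝ E = n) (T : E →ₗ[ℝ] E) :
    ∃ u v : OrthonormalBasis (Fin n) ℝ E, ∀ i : Fin n, T (v i) = T.singularValues i • u i := by
  let v := T.isSymmetric_adjoint_comp_self.eigenvectorBasis hn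
  have hin : ∀ i j, ⟪T (v i), T (v j)⟫ = T.singularValues j ^ 2 * ⟪v i, v j⟫ := fun i j => by
    rw [← LinearMap.adjoint_inner_right, ← LinearMap.comp_apply,
      LinearMap.IsSymmetric.apply_eigenvectorBasis, T.sq_singularValues_fin hn]
    simp [inner_smul_right, v]
  let s : Set (Fin n) := {i | T.singularValues i ≠ 0}
  have hs : Orthonormal ℝ (s.domRestrict fun i => (T.singularValues i)⁻¹ • T (v i)) := by
    rw [orthonormal_iff_ite]
    rintro ⟨i, hi⟩ ⟨j, hj⟩
    simp only [Set.domRestrict_apply, inner_smul_left, inner_smul_right, hin, Subtype.mk.injEq]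
    rw [orthonormal_iff_ite.1 v.orthonormal i j]
    split_ifs with h
    · subst h
      have : T.singularValues i ≠ 0 := hi
      simp; field_simp
    · simp
  -- The vectors `T (v i) / σᵢ` with `σᵢ ≠ 0` are orthonormal and extend to a basis.
  obtain ⟨u, hu⟩ := hs.exists_orthonormalBasis_extension_of_card_eq (by simpa using hn)
  refine ⟨u, v, fun i => ?_⟩
  by_cases hi : T.singularValues i = 0
  · have := hin i i
    rw [hi] at this
    rw [hi, zero_smul, ← inner_self_eq_zero (𝕜 := ℝ), this]
    simp
  · rw [hu i hi, smul_smul, mul_inv_cancel₀ hi, one_smul]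

theorem norm_sq_apply_of_svd {ι : Type*} [Fintype ι] {u v : OrthonormalBasis ι ℝ E}
    {T : E →ₗ[ℝ] E} {d : ι → ℝ} (h : ∀ i, T (v i) = d i • u i) (x : E) :
    ‖T x‖ ^ 2 = ∑ i, d i ^ 2 * ⟪v i, x⟫ ^ 2 := by
  have : ∀ i, ⟪u i, T x⟫ = d i * ⟪v i, x⟫ := fun i => by
    conv_lhs => rw [← v.sum_repr x, map_sum]
    simp only [map_smul, h, inner_sum, inner_smul_right, OrthonormalBasis.repr_apply_apply]
    rw [Finset.sum_eq_single i]
    · simp; ring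
    · intro j _ hj
      rw [u.inner_eq_zero hj.symm]; simp
    · simp
  rw [← u.sum_sq_inner_right]
  exact Finset.sum_congr rfl fun i _ => by rw [this, mul_pow]

theorem inner_apply_of_svd {ι : Type*} [Fintype ι] {u v : OrthonormalBasis ι ℝ E}
    {T : E →ₗ[ℝ] E} {d : ι → ℝ} (h : ∀ i, T (v i) = d i • u i) (x y : E) :
    ⟪T x, y⟫ = ∑ i, d i * (⟪v i, x⟫ * ⟪u i, y⟫) := by
  conv_lhs => rw [← v.sum_repr x, map_sum]
  simp only [map_smul, h, sum_inner, inner_smul_left, OrthonormalBasis.repr_apply_apply]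
  exact Finset.sum_congr rfl fun i _ => by simp; ring

/-- Weyl's inequality for a rank one perturbation: a unit vector orthogonal to `v`, to the leading
`i` right singular vectors of `T` and to those of `R` with index above `i + 1` separates the two
singular values. -/
theorem singularValues_succ_le_of_rankOne [FiniteDimensional ℝ E] {T R : E →ₗ[ℝ] E} {v : E}
    (h : ∀ x, ⟪v, x⟫ = 0 → R x = T x) (i : ℕ) : R.singularValues (i + 1) ≤ T.singularValues i := by
  rcases le_or_gt (finrank ℝ E) (i + 1) with hi | hi
  · rw [R.singularValues_of_finrank_le hi]
    exact T.singularValues_nonneg i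
  obtain ⟨u₁, v₁, h₁⟩ := exists_svd rfl T
  obtain ⟨u₂, v₂, h₂⟩ := exists_svd rfl R
  obtain ⟨x, hx0, hx⟩ := exists_ne_zero_inner_eq_zero
    (fun j : {j : Fin (finrank ℝ E) // j ≠ ⟨i + 1, hi⟩} =>
      if j.1.1 < i then v₁ j else if j.1.1 = i then v else v₂ j) (by
      conv_rhs => rw [← Fintype.card_fin (finrank ℝ E)]
      exact Fintype.card_subtype_lt (x := ⟨i + 1, hi⟩) (by simp))
  have hv : ⟪v, x⟫ = 0 := by
    simpa using hx ⟨⟨i, by omega⟩, by simp⟩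
  have e1 : ‖T x‖ ^ 2 ≤ T.singularValues i ^ 2 * ‖x‖ ^ 2 := by
    rw [norm_sq_apply_of_svd h₁]
    refine sum_mul_inner_sq_le v₁ fun j => ?_
    rcases lt_or_ge j.1 i with hj | hj
    · have := hx ⟨j, by rintro rfl; simp at hj⟩
      rw [if_pos hj] at this
      exact Or.inl this
    · exact Or.inr (pow_le_pow_left₀ (T.singularValues_nonneg _) (T.singularValues_antitone hj) 2)
  have e2 : R.singularValues (i + 1) ^ 2 * ‖x‖ ^ 2 ≤ ‖R x‖ ^ 2 := by
    rw [norm_sq_apply_of_svd h₂]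
    refine le_sum_mul_inner_sq v₂ fun j => ?_
    rcases lt_or_ge (i + 1) j.1 with hj | hj
    · have := hx ⟨j, by rintro rfl; simp at hj⟩
      rw [if_neg (show ¬ j.1 < i by omega), if_neg (show ¬ j.1 = i by omega)] at this
      exact Or.inl this
    · exact Or.inr (pow_le_pow_left₀ (R.singularValues_nonneg _) (R.singularValues_antitone hj) 2)
  rw [h x hv] at e2
  have : 0 < ‖x‖ ^ 2 := by positivity
  exact le_of_sq_le_sq (le_of_mul_le_mul_right (e2.trans e1) this) (T.singularValues_nonneg i)

end SVD

end LowRank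

/-! ### The concave Mirsky inequality -/

namespace LowRank

open Module InnerProductSpace
open scoped RealInnerProductSpace

section SVD

variable {E : Type*} [NormedAddCommGroup E] [InnerProductSpace ℝ E] [FiniteDimensional ℝ E]
variable {n : ℕ}

/-- The basis `(v i, u i) / √2`, `(v i, -u i) / √2` in which the self-adjoint dilation
`(x, y) ↦ (T† y, T x)` of an operator with singular vectors `v i`, `u i` is diagonal. The
order of the index type is the decreasing order of the eigenvalues `σ₀, …, σₙ₋₁, -σₙ₋₁, …, -σ₀`. -/
theorem exists_dilation_basis (hn : finrank ℝ E = n) (u v : OrthonormalBasis (Fin n) ℝ E) :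
    ∃ e : OrthonormalBasis (Fin n ⊕ₗ (Fin n)ᵒᵈ) ℝ (WithLp 2 (E × E)),
      (∀ i x, ⟪e (Sum.inlₗ i), x⟫ = (√2)⁻¹ * (⟪v i, x.fst⟫ + ⟪u i, x.snd⟫)) ∧
      ∀ i x, ⟪e (Sum.inrₗ (OrderDual.toDual i)), x⟫ = (√2)⁻¹ * (⟪v i, x.fst⟫ - ⟪u i, x.snd⟫) := by
  let e₀ : Fin n ⊕ₗ (Fin n)ᵒᵈ → WithLp 2 (E × E) := fun k =>
    Sum.elim (fun i => (√2)⁻¹ • WithLp.toLp 2 (v i, u i))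
      (fun i => (√2)⁻¹ • WithLp.toLp 2 (v (OrderDual.ofDual i), -u (OrderDual.ofDual i)))
      (ofLex k)
  have h1 : ∀ i x, ⟪e₀ (Sum.inlₗ i), x⟫ = (√2)⁻¹ * (⟪v i, x.fst⟫ + ⟪u i, x.snd⟫) := fun i x => by
    simp [e₀, inner_smul_left, WithLp.prod_inner_apply]
  have h2 : ∀ i x, ⟪e₀ (Sum.inrₗ (OrderDual.toDual i)), x⟫
      = (√2)⁻¹ * (⟪v i, x.fst⟫ - ⟪u i, x.snd⟫) := fun i x => by
    simp [e₀, inner_smul_left, WithLp.prod_inner_apply, sub_eq_add_neg]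
  have hs : (√2)⁻¹ * ((√2)⁻¹ * 2) = 1 := by
    rw [← mul_assoc, ← mul_inv, Real.mul_self_sqrt (by norm_num)]; norm_num
  have hv := orthonormal_iff_ite.1 v.orthonormal
  have hu := orthonormal_iff_ite.1 u.orthonormal
  have ho : Orthonormal ℝ e₀ := by
    rw [orthonormal_iff_ite]
    intro k l
    obtain ⟨k, rfl⟩ := toLex.surjective k
    obtain ⟨l, rfl⟩ := toLex.surjective l
    rcases k with i | i
    · refine (h1 i _).trans ?_
      rcases l with j | j
      · by_cases hij : i = j <;> simp [e₀, inner_smul_right, hu, hv, hij]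
        rw [← two_mul, mul_comm 2, hs]
      · obtain ⟨j, rfl⟩ := OrderDual.toDual.surjective j
        by_cases hij : i = j <;> simp [e₀, inner_smul_right, hu, hv, hij]
    · obtain ⟨i, rfl⟩ := OrderDual.toDual.surjective i
      refine (h2 i _).trans ?_
      rcases l with j | j
      · by_cases hij : i = j <;> simp [e₀, inner_smul_right, hu, hv, hij]
      · obtain ⟨j, rfl⟩ := OrderDual.toDual.surjective j
        by_cases hij : i = j <;> simp [e₀, inner_smul_right, hu, hv, hij]
        rw [← two_mul, mul_comm 2, hs]
  have hc : Fintype.card (Fin n ⊕ₗ (Fin n)ᵒᵈ) = finrank ℝ (WithLp 2 (E × E)) := by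
    rw [(WithLp.linearEquiv 2 ℝ (E × E)).finrank_eq, finrank_prod, hn]
    simp
  let e := OrthonormalBasis.mk ho
    (ho.linearIndependent.span_eq_top_of_card_eq_finrank' hc).ge
  refine ⟨e, fun i x => ?_, fun i x => ?_⟩
  · rw [OrthonormalBasis.coe_mk, h1]
  · rw [OrthonormalBasis.coe_mk, h2]

/-- The rank one update `c u vᵀ` changes the self-adjoint dilation by `w wᵀ - z zᵀ` with
`w, z = √(c / 2) (v, ±u)`, and the spectrum of the dilation is `±σᵢ`. -/
theorem sum_abs_singularValues_sub_le_of_rankOne (hn : finrank ℝ E = n) {T R : E →ₗ[ℝ] E}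
    {u v : E} (hu : ‖u‖ = 1) (hv : ‖v‖ = 1) {c : ℝ} (hc : 0 ≤ c)
    (h : ∀ x, R x = T x + (c * ⟪v, x⟫) • u) :
    ∑ i : Fin n, |T.singularValues i - R.singularValues i| ≤ c := by
  obtain ⟨u₁, v₁, h₁⟩ := exists_svd hn T
  obtain ⟨u₂, v₂, h₂⟩ := exists_svd hn R
  obtain ⟨e, he, he'⟩ := exists_dilation_basis hn u₁ v₁
  obtain ⟨f, hf, hf'⟩ := exists_dilation_basis hn u₂ v₂
  -- The eigenvalues `σ₀, …, σₙ₋₁, -σₙ₋₁, …, -σ₀` of the dilation, in decreasing order.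
  let spec : (ℕ →₀ ℝ) → Fin n ⊕ₗ (Fin n)ᵒᵈ → ℝ := fun σ k =>
    Sum.elim (fun i : Fin n => σ i) (fun i : (Fin n)ᵒᵈ => -σ (OrderDual.ofDual i : Fin n)) (ofLex k)
  have hspec : ∀ A : E →ₗ[ℝ] E, Antitone (spec A.singularValues) := by
    intro A k l hkl
    obtain ⟨k, rfl⟩ := toLex.surjective k
    obtain ⟨l, rfl⟩ := toLex.surjective l
    rcases k with i | i <;> rcases l with j | j
    · have hij : i ≤ j := Sum.Lex.inl_le_inl_iff.1 hkl
      exact A.singularValues_antitone hij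
    · exact (neg_nonpos.2 (A.singularValues_nonneg _)).trans (A.singularValues_nonneg _)
    · exact absurd hkl Sum.Lex.not_inr_le_inl
    · have hij : i ≤ j := Sum.Lex.inr_le_inr_iff.1 hkl
      exact neg_le_neg (A.singularValues_antitone (OrderDual.ofDual_le_ofDual.2 hij))
  have hsum : ∀ g : Fin n ⊕ₗ (Fin n)ᵒᵈ → ℝ, ∑ k, g k
      = ∑ i, (g (Sum.inlₗ i) + g (Sum.inrₗ (OrderDual.toDual i))) := by
    intro g
    rw [← toLex.sum_comp, Fintype.sum_sum_type, Finset.sum_add_distrib]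
    rfl
  have hs : (√2)⁻¹ ^ 2 = (2 : ℝ)⁻¹ := by
    rw [inv_pow, Real.sq_sqrt (by norm_num)]
  obtain ⟨r, hr⟩ : ∃ r : ℝ, r ^ 2 = c / 2 := ⟨√(c / 2), Real.sq_sqrt (by positivity)⟩
  have key := sum_abs_eigenvalue_sub_le e f (hspec T) (hspec R)
    (r • WithLp.toLp 2 (v, u)) (r • WithLp.toLp 2 (v, -u)) (fun x => by
      have i1 := inner_apply_of_svd h₁ x.fst x.snd
      have t1 : ∑ k, spec T.singularValues k * ⟪e k, x⟫ ^ 2 = 2 * ⟪T x.fst, x.snd⟫ := by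
        rw [hsum, i1, Finset.mul_sum]
        refine Finset.sum_congr rfl fun i _ => ?_
        simp only [he, he', mul_pow, hs]
        simp [spec]
        ring
      have t2 : ∑ k, spec R.singularValues k * ⟪f k, x⟫ ^ 2 = 2 * ⟪R x.fst, x.snd⟫ := by
        rw [hsum, inner_apply_of_svd h₂ x.fst x.snd, Finset.mul_sum]
        refine Finset.sum_congr rfl fun i _ => ?_
        simp only [hf, hf', mul_pow, hs]
        simp [spec]
        ring
      rw [t1, t2, h, inner_add_left, inner_smul_left, inner_smul_left, inner_smul_left]
      simp only [WithLp.prod_inner_apply, inner_neg_left, mul_pow]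
      simp
      rw [hr]
      ring)
  rw [hsum] at key
  have hw : ∀ u' : E, ‖u'‖ = 1 → ‖r • WithLp.toLp 2 (v, u')‖ ^ 2 = c := fun u' hu' => by
    rw [norm_smul, mul_pow, WithLp.prod_norm_sq_eq_of_L2]
    simp [hv, hu', hr]
    ring
  -- Every displacement `|σᵢ(T) - σᵢ(R)|` occurs twice in the dilation.
  rw [hw _ hu, hw _ (by simpa using hu)] at key
  have : ∑ i, (|spec T.singularValues (Sum.inlₗ i) - spec R.singularValues (Sum.inlₗ i)|
      + |spec T.singularValues (Sum.inrₗ (OrderDual.toDual i))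
        - spec R.singularValues (Sum.inrₗ (OrderDual.toDual i))|)
      = 2 * ∑ i : Fin n, |T.singularValues i - R.singularValues i| := by
    rw [Finset.mul_sum]
    refine Finset.sum_congr rfl fun i _ => ?_
    have h1 : spec T.singularValues (Sum.inrₗ (OrderDual.toDual i))
        - spec R.singularValues (Sum.inrₗ (OrderDual.toDual i))
        = -(T.singularValues i - R.singularValues i) := by simp [spec]; ring
    rw [h1, abs_neg, two_mul]
    rfl
  linarith

/-- Increments of a concave function over disjoint intervals `[m i, M i]`, listed from right to
left, add up to at most its increment over `[0, c]` with `c` the total length: sliding every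
interval to the left, until they are adjacent, only makes the increments larger. -/
theorem sum_concave_sub_le {f : ℝ → ℝ} (hf : ConcaveOn ℝ (Set.Ici 0) f) (hf0 : f 0 = 0) (k : ℕ) :
    ∀ M m : ℕ → ℝ, (∀ i, 0 ≤ m i) → (∀ i, m i ≤ M i) → (∀ i, M (i + 1) ≤ m i) →
      ∑ i ∈ Finset.range k, (M i - m i) ≤ M 0 ∧
      ∑ i ∈ Finset.range k, (f (M i) - f (m i)) ≤ f (∑ i ∈ Finset.range k, (M i - m i)) := by
  induction k with
  | zero => exact fun M m h0 h1 _ => ⟨by simpa using (h0 0).trans (h1 0), by simp [hf0]⟩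
  | succ k ih =>
    intro M m h0 h1 h2
    obtain ⟨i1, i2⟩ := ih (fun i => M (i + 1)) (fun i => m (i + 1)) (fun i => h0 _)
      (fun i => h1 _) (fun i => h2 _)
    rw [Finset.sum_range_succ', Finset.sum_range_succ']
    have hs : 0 ≤ ∑ i ∈ Finset.range k, (M (i + 1) - m (i + 1)) :=
      Finset.sum_nonneg fun i _ => sub_nonneg.2 (h1 _)
    set s := ∑ i ∈ Finset.range k, (M (i + 1) - m (i + 1))
    have hsm : s ≤ m 0 := i1.trans (h2 0)
    refine ⟨by linarith, ?_⟩
    have key : f (M 0) + f s ≤ f (s + (M 0 - m 0)) + f (m 0) := by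
      rcases eq_or_lt_of_le (hsm.trans (h1 0)) with h | h
      · have e1 : m 0 = s := le_antisymm (h ▸ h1 0) hsm
        simp [e1, h]
      have hd : 0 < M 0 - s := sub_pos.2 h
      have hM : M 0 ∈ Set.Ici (0 : ℝ) := (h0 0).trans (h1 0)
      have hsum : (M 0 - m 0) / (M 0 - s) + (m 0 - s) / (M 0 - s) = 1 := by
        field_simp; ring
      have ha : 0 ≤ (M 0 - m 0) / (M 0 - s) := div_nonneg (sub_nonneg.2 (h1 0)) hd.le
      have hb : 0 ≤ (m 0 - s) / (M 0 - s) := div_nonneg (sub_nonneg.2 hsm) hd.le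
      have c1 := hf.2 (Set.mem_Ici.2 hs) hM hb ha (by rw [add_comm, hsum])
      have c2 := hf.2 (Set.mem_Ici.2 hs) hM ha hb hsum
      have e1 : ((m 0 - s) / (M 0 - s)) • s + ((M 0 - m 0) / (M 0 - s)) • M 0
          = s + (M 0 - m 0) := by
        simp only [smul_eq_mul]; field_simp; ring
      have e2 : ((M 0 - m 0) / (M 0 - s)) • s + ((m 0 - s) / (M 0 - s)) • M 0 = m 0 := by
        simp only [smul_eq_mul]; field_simp; ring
      rw [e1] at c1
      rw [e2] at c2
      simp only [smul_eq_mul] at c1 c2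
      linear_combination c1 + c2 - (f s + f (M 0)) * hsum
    linarith

/-- The concave Mirsky inequality for a rank one perturbation: the singular values of `T` and `R`
interlace, so that the intervals between them are disjoint, and their total length is at
most `c`. -/
theorem sum_abs_concave_sub_le_of_rankOne (hn : finrank ℝ E = n) {T R : E →ₗ[ℝ] E}
    {u v : E} (hu : ‖u‖ = 1) (hv : ‖v‖ = 1) {c : ℝ} (hc : 0 ≤ c)
    (h : ∀ x, R x = T x + (c * ⟪v, x⟫) • u) {f : ℝ → ℝ} (hf : ConcaveOn ℝ (Set.Ici 0) f)
    (hmono : MonotoneOn f (Set.Ici 0)) (hf0 : f 0 = 0) :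
    ∑ i : Fin n, |f (T.singularValues i) - f (R.singularValues i)| ≤ f c := by
  have hTR : ∀ x, ⟪v, x⟫ = 0 → R x = T x := fun x hx => by simp [h, hx]
  have w1 := singularValues_succ_le_of_rankOne hTR
  have w2 := singularValues_succ_le_of_rankOne fun x hx => (hTR x hx).symm
  have hT := T.singularValues_nonneg
  have hR := R.singularValues_nonneg
  have hlen := sum_abs_singularValues_sub_le_of_rankOne hn hu hv hc h
  obtain ⟨-, h2⟩ := sum_concave_sub_le hf hf0 n
    (fun i => max (T.singularValues i) (R.singularValues i))
    (fun i => min (T.singularValues i) (R.singularValues i))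
    (fun i => le_min (hT i) (hR i)) (fun i => min_le_max)
    (fun i => max_le (le_min (T.singularValues_antitone i.le_succ) (w2 i))
      (le_min (w1 i) (R.singularValues_antitone i.le_succ)))
  simp only [max_sub_min_eq_abs', Finset.sum_range] at h2
  refine le_trans (Finset.sum_le_sum fun i _ => ?_)
    (h2.trans (hmono (Set.mem_Ici.2 (Finset.sum_nonneg fun i _ => abs_nonneg _)) hc ?_))
  · rcases le_total (T.singularValues i) (R.singularValues i) with hi | hi
    · rw [max_eq_right hi, min_eq_left hi, abs_sub_comm,
        abs_of_nonneg (sub_nonneg.2 (hmono (hT i) (hR i) hi))]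
    · rw [max_eq_left hi, min_eq_right hi,
        abs_of_nonneg (sub_nonneg.2 (hmono (hR i) (hT i) hi))]
  · simpa only [abs_sub_comm] using hlen

/-- The concave Mirsky inequality: the singular value decomposition of `A - B` leads from `B`
to `A` in rank one steps. -/
theorem sum_abs_concave_singularValues_sub_le (hn : finrank ℝ E = n) (A B : E →ₗ[ℝ] E)
    {f : ℝ → ℝ} (hf : ConcaveOn ℝ (Set.Ici 0) f) (hmono : MonotoneOn f (Set.Ici 0))
    (hf0 : f 0 = 0) :
    ∑ i : Fin n, |f (A.singularValues i) - f (B.singularValues i)|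
      ≤ ∑ i : Fin n, f ((A - B).singularValues i) := by
  obtain ⟨u, v, huv⟩ := exists_svd hn (A - B)
  have key : ∀ I : Finset (Fin n), ∀ T : E →ₗ[ℝ] E,
      (∀ x, T x = B x + ∑ i ∈ I, ((A - B).singularValues i * ⟪v i, x⟫) • u i) →
      ∑ i : Fin n, |f (T.singularValues i) - f (B.singularValues i)|
        ≤ ∑ i ∈ I, f ((A - B).singularValues i) := by
    intro I
    induction I using Finset.induction_on with
    | empty =>
      intro T hT
      have : T = B := LinearMap.ext fun x => by simp [hT]
      simp [this]
    | insert k I hk ih =>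
      intro T hT
      let R : E →ₗ[ℝ] E :=
        T - (A - B).singularValues k • (rankOne ℝ (u k) (v k) : E →L[ℝ] E)
      have hR : ∀ x, T x = R x + ((A - B).singularValues k * ⟪v k, x⟫) • u k := fun x => by
        simp [R, smul_smul]
      have h1 := ih R fun x => by
        have := hR x
        rw [hT, Finset.sum_insert hk] at this
        rw [← add_right_cancel_iff (a := ((A - B).singularValues k * ⟪v k, x⟫) • u k), ← this]
        abel
      have h2 := sum_abs_concave_sub_le_of_rankOne hn (u.norm_eq_one k) (v.norm_eq_one k)
        ((A - B).singularValues_nonneg k) hR hf hmono hf0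
      rw [Finset.sum_insert hk]
      refine le_trans ?_ (add_le_add h2 h1)
      rw [← Finset.sum_add_distrib]
      refine Finset.sum_le_sum fun i _ => ?_
      rw [abs_sub_comm (f (R.singularValues i)) (f (T.singularValues i))]
      exact abs_sub_le _ _ _
  refine key Finset.univ A fun x => ?_
  rw [← sub_eq_iff_eq_add', ← LinearMap.sub_apply]
  conv_lhs => rw [← v.sum_repr x, map_sum]
  refine Finset.sum_congr rfl fun i _ => ?_
  rw [map_smul, huv, smul_smul, OrthonormalBasis.repr_apply_apply, mul_comm]

end SVD

end LowRank

/-! ### Recovery of vectors from block estimates -/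

namespace LowRank

open Module InnerProductSpace
open scoped RealInnerProductSpace

section Blocks

variable {F : Type*} [NormedAddCommGroup F] [InnerProductSpace ℝ F]

/-- Almost orthogonality of the images of two orthogonal blocks of norms `c` and `d`, by
polarization. -/
theorem abs_inner_le_of_frame {x y : F} {c d a b : ℝ} (hc : 0 ≤ c) (hd : 0 ≤ d)
    (hlow : ∀ ξ η : ℝ, a * (ξ ^ 2 * c ^ 2 + η ^ 2 * d ^ 2) ≤ ‖ξ • x + η • y‖ ^ 2)
    (hup : ∀ ξ η : ℝ, ‖ξ • x + η • y‖ ^ 2 ≤ b * (ξ ^ 2 * c ^ 2 + η ^ 2 * d ^ 2)) :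
    |⟪x, y⟫| ≤ (b - a) / 2 * (c * d) := by
  rcases hc.eq_or_lt with rfl | hc
  · have := hup 1 0
    simp at this
    simp [this]
  rcases hd.eq_or_lt with rfl | hd
  · have := hup 0 1
    simp at this
    simp [this]
  have key : ∀ ξ η : ℝ, ‖ξ • x + η • y‖ ^ 2
      = ξ ^ 2 * ‖x‖ ^ 2 + 2 * (ξ * η) * ⟪x, y⟫ + η ^ 2 * ‖y‖ ^ 2 := fun ξ η => by
    rw [norm_add_sq_real, norm_smul, norm_smul, mul_pow, mul_pow, inner_smul_left,
      inner_smul_right]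
    simp
    ring
  -- The weights `d, ±c` make the two summands equally long.
  have l1 := hlow d c
  have l2 := hlow d (-c)
  have u1 := hup d c
  have u2 := hup d (-c)
  rw [key] at l1 l2 u1 u2
  have hcd : 0 < c * d := mul_pos hc hd
  rw [abs_le]
  constructor
  · refine le_of_mul_le_mul_left (a := 4 * (c * d)) ?_ (by positivity)
    linear_combination l1 + u2
  · refine le_of_mul_le_mul_left (a := 4 * (c * d)) ?_ (by positivity)
    linear_combination l2 + u1

/-- The point `(x, y)` lies in a disc with center `(g / 2, g / 2)` and radius `g / √2`. -/
theorem le_of_sq_add_sq_le {x y g : ℝ} (hg : 0 ≤ g) (h : x ^ 2 + y ^ 2 ≤ (x + y) * g) :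
    x ≤ (1 + √2) / 2 * g := by
  have h2 : √2 ^ 2 = 2 := Real.sq_sqrt (by norm_num)
  have h3 : (x - g / 2) ^ 2 ≤ (√2 / 2 * g) ^ 2 := by
    rw [mul_pow, div_pow, h2]
    nlinarith [sq_nonneg (y - g / 2)]
  have := abs_le_of_sq_le_sq' h3 (by positivity)
  linarith [this.2]

/-- The two leading blocks are controlled by the remaining ones and by the image of the whole
vector. Here `h k` is the image of a block of Euclidean norm `c k`. -/
theorem block_norm_le {h : ℕ → F} {c : ℕ → ℝ} {α β : ℝ} (hα : 0 < α) (hαβ : α ≤ β)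
    (hc : ∀ k, 0 ≤ c k)
    (hlow : ∀ j k, j ≠ k → ∀ ξ η : ℝ,
      α ^ 2 * (ξ ^ 2 * c j ^ 2 + η ^ 2 * c k ^ 2) ≤ ‖ξ • h j + η • h k‖ ^ 2)
    (hup : ∀ j k, j ≠ k → ∀ ξ η : ℝ,
      ‖ξ • h j + η • h k‖ ^ 2 ≤ β ^ 2 * (ξ ^ 2 * c j ^ 2 + η ^ 2 * c k ^ 2)) (K : ℕ) {g : ℝ}
    (hg : g = (β ^ 2 / α ^ 2 - 1) / 2 * ∑ k ∈ Finset.range K, c (k + 2)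
      + β / α ^ 2 * ‖∑ k ∈ Finset.range (K + 2), h k‖) :
    c 0 ≤ (1 + √2) / 2 * g ∧ c 1 ≤ (1 + √2) / 2 * g := by
  have hβ : 0 < β := hα.trans_le hαβ
  set w := ∑ k ∈ Finset.range (K + 2), h k with hw
  have hw' : w = h 0 + h 1 + ∑ k ∈ Finset.range K, h (k + 2) := by
    rw [hw, Finset.sum_range_succ', Finset.sum_range_succ']
    simp
    abel
  have hS : 0 ≤ ∑ k ∈ Finset.range K, c (k + 2) := Finset.sum_nonneg fun k _ => hc _
  set S := ∑ k ∈ Finset.range K, c (k + 2) with hSdef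
  have hγ : 0 ≤ β ^ 2 / α ^ 2 - 1 := by
    rw [sub_nonneg, one_le_div (by positivity)]
    gcongr
  have hg0 : 0 ≤ g := by rw [hg]; positivity
  have n1 : ‖h 0 + h 1‖ ≤ β * (c 0 + c 1) := by
    have := hup 0 1 (by norm_num) 1 1
    simp only [one_smul, one_pow, one_mul] at this
    refine le_of_sq_le_sq (this.trans ?_) (mul_nonneg hβ.le (add_nonneg (hc 0) (hc 1)))
    nlinarith [mul_nonneg (sq_nonneg β) (mul_nonneg (hc 0) (hc 1))]
  have n2 : ∀ k, -⟪h 0 + h 1, h (k + 2)⟫ ≤ (β ^ 2 - α ^ 2) / 2 * (c 0 + c 1) * c (k + 2) := by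
    intro k
    have i0 := abs_inner_le_of_frame (hc 0) (hc (k + 2)) (hlow 0 (k + 2) (by omega))
      (hup 0 (k + 2) (by omega))
    have i1 := abs_inner_le_of_frame (hc 1) (hc (k + 2)) (hlow 1 (k + 2) (by omega))
      (hup 1 (k + 2) (by omega))
    rw [inner_add_left]
    linarith [neg_le_of_abs_le i0, neg_le_of_abs_le i1]
  have n3 : α ^ 2 * (c 0 ^ 2 + c 1 ^ 2)
      ≤ β * (c 0 + c 1) * ‖w‖ + (β ^ 2 - α ^ 2) / 2 * (c 0 + c 1) * S := by
    have e0 := hlow 0 1 (by norm_num) 1 1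
    simp only [one_smul, one_pow, one_mul] at e0
    have e1 : ‖h 0 + h 1‖ ^ 2 = ⟪h 0 + h 1, w⟫ + ∑ k ∈ Finset.range K, -⟪h 0 + h 1, h (k + 2)⟫ := by
      rw [hw', inner_add_right, real_inner_self_eq_norm_sq, inner_sum, Finset.sum_neg_distrib]
      ring
    have e2 : ⟪h 0 + h 1, w⟫ ≤ β * (c 0 + c 1) * ‖w‖ :=
      (real_inner_le_norm _ _).trans (by gcongr)
    have e3 := Finset.sum_le_sum fun k (_ : k ∈ Finset.range K) => n2 k
    rw [← Finset.mul_sum] at e3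
    linarith
  have n4 : c 0 ^ 2 + c 1 ^ 2 ≤ (c 0 + c 1) * g := by
    refine le_of_mul_le_mul_left (a := α ^ 2) (n3.trans_eq ?_) (by positivity)
    rw [hg]
    field_simp
    ring
  exact ⟨le_of_sq_add_sq_le hg0 n4, le_of_sq_add_sq_le (y := c 0) hg0 (by linarith)⟩

/-- The consecutive blocks of indices: first `s` of them, then `t` at a time. -/
def block (s t : ℕ) : ℕ → Finset ℕ
  | 0 => Finset.range s
  | k + 1 => Finset.Ico (s + k * t) (s + (k + 1) * t)

theorem sum_block_succ (s t K : ℕ) (f : ℕ → ℝ) :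
    ∑ k ∈ Finset.range K, ∑ i ∈ block s t (k + 1), f i
      = ∑ i ∈ Finset.Ico s (s + K * t), f i := by
  induction K with
  | zero => simp
  | succ K ih =>
    rw [Finset.sum_range_succ, ih, block, Finset.sum_Ico_consecutive _ (by simp) (by gcongr; simp)]

theorem sum_block (s t K : ℕ) (f : ℕ → ℝ) :
    ∑ k ∈ Finset.range (K + 1), ∑ i ∈ block s t k, f i = ∑ i ∈ Finset.range (s + K * t), f i := by
  rw [Finset.sum_range_succ', sum_block_succ, block, add_comm,
    Finset.sum_range_add_sum_Ico _ (by simp)]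

theorem block_disjoint {s t j k : ℕ} (h : j ≠ k) : Disjoint (block s t j) (block s t k) := by
  wlog hjk : j < k generalizing j k
  · exact (this h.symm (by omega)).symm
  rw [Finset.disjoint_left]
  intro i hi hi'
  obtain ⟨k, rfl⟩ : ∃ l, k = l + 1 := ⟨k - 1, by omega⟩
  simp only [block, Finset.mem_Ico] at hi'
  cases j with
  | zero => simp only [block, Finset.mem_range] at hi; omega
  | succ j =>
    simp only [block, Finset.mem_Ico] at hi
    have : (j + 1) * t ≤ k * t := Nat.mul_le_mul_right t (by omega)
    omega

theorem card_block_le {s t : ℕ} (hst : s ≤ t) (k : ℕ) : (block s t k).card ≤ t := by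
  cases k with
  | zero => simpa [block] using hst
  | succ k =>
    simp only [block, Nat.card_Ico]
    rw [add_mul]
    omega

theorem sum_rpow_le_rpow_sum {ι : Type*} (I : Finset ι) {x : ι → ℝ} (hx : ∀ i, 0 ≤ x i) {r : ℝ}
    (hr : 1 ≤ r) : ∑ i ∈ I, x i ^ r ≤ (∑ i ∈ I, x i) ^ r := by
  classical
  induction I using Finset.induction_on with
  | empty => simp [Real.zero_rpow (by linarith : r ≠ 0)]
  | insert i I hi ih =>
    rw [Finset.sum_insert hi, Finset.sum_insert hi]
    exact (add_le_add_right ih _).trans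
      (Real.add_rpow_le_rpow_add (hx i) (Finset.sum_nonneg fun j _ => hx j) hr)

/-- The Euclidean norm of a block against the `ℓ_p` norm of the previous one: every entry of the
block is at most the `p`-mean of the previous block. -/
theorem sqrt_sum_block_le {p : ℝ} (hp : 0 < p) {s t : ℕ} (ht : 1 ≤ t) {v : ℕ → ℝ}
    (hv : Antitone v) (hv0 : ∀ i, 0 ≤ v i) (k : ℕ) :
    √(∑ i ∈ block s t (k + 2), v i ^ 2)
      ≤ ((t : ℝ) ^ (1 / p - 1 / 2))⁻¹ * (∑ i ∈ block s t (k + 1), v i ^ p) ^ (1 / p) := by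
  have ht0 : (0 : ℝ) < t := by exact_mod_cast ht
  set x := v (s + (k + 1) * t)
  have hx : 0 ≤ x := hv0 _
  have h1 : ∑ i ∈ block s t (k + 2), v i ^ 2 ≤ t * x ^ 2 := by
    have := Finset.sum_le_card_nsmul (block s t (k + 2)) (fun i => v i ^ 2) (x ^ 2) fun i hi => by
      simp only [block, Finset.mem_Ico] at hi
      exact pow_le_pow_left₀ (hv0 i) (hv hi.1) 2
    have hcard : (block s t (k + 2)).card = t := by simp only [block, Nat.card_Ico]; lia
    simpa [hcard] using this
  have h2 : t * x ^ p ≤ ∑ i ∈ block s t (k + 1), v i ^ p := by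
    have := Finset.card_nsmul_le_sum (block s t (k + 1)) (fun i => v i ^ p) (x ^ p) fun i hi => by
      simp only [block, Finset.mem_Ico] at hi
      exact Real.rpow_le_rpow hx (hv hi.2.le) hp.le
    have hcard : (block s t (k + 1)).card = t := by simp only [block, Nat.card_Ico]; lia
    simpa [hcard] using this
  calc √(∑ i ∈ block s t (k + 2), v i ^ 2) ≤ √(t * x ^ 2) := Real.sqrt_le_sqrt h1
    _ = (t : ℝ) ^ (1 / 2 : ℝ) * x := by
      rw [Real.sqrt_mul ht0.le, Real.sqrt_sq hx, Real.sqrt_eq_rpow]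
    _ = ((t : ℝ) ^ (1 / p - 1 / 2))⁻¹ * (t * x ^ p) ^ (1 / p) := by
      rw [Real.mul_rpow ht0.le (by positivity), ← Real.rpow_mul hx, mul_one_div_cancel hp.ne',
        Real.rpow_one, ← Real.rpow_neg ht0.le, ← mul_assoc, ← Real.rpow_add ht0]
      congr 2
      ring
    _ ≤ _ := by gcongr

theorem sum_sqrt_sum_block_le {p : ℝ} (hp : 0 < p) (hp1 : p ≤ 1) {s t : ℕ} (ht : 1 ≤ t) {v : ℕ → ℝ}
    (hv : Antitone v) (hv0 : ∀ i, 0 ≤ v i) (K : ℕ) :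
    ∑ k ∈ Finset.range K, √(∑ i ∈ block s t (k + 2), v i ^ 2)
      ≤ ((t : ℝ) ^ (1 / p - 1 / 2))⁻¹ * (∑ i ∈ Finset.Ico s (s + K * t), v i ^ p) ^ (1 / p) := by
  refine (Finset.sum_le_sum fun k _ => sqrt_sum_block_le hp ht hv hv0 k).trans ?_
  rw [← Finset.mul_sum, ← sum_block_succ]
  gcongr
  refine sum_rpow_le_rpow_sum _ (fun k => Finset.sum_nonneg fun i _ => ?_) ?_
  · exact Real.rpow_nonneg (hv0 i) p
  · rw [le_div_iff₀ hp]; linarith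

/-- Comparison of the `ℓ_p` and `ℓ_2` norms of a vector of length `s`. -/
theorem sum_range_rpow_le {p : ℝ} (hp : 0 < p) (hp1 : p ≤ 1) {s : ℕ} (hs : 1 ≤ s) {v : ℕ → ℝ}
    (hv0 : ∀ i, 0 ≤ v i) :
    (∑ i ∈ Finset.range s, v i ^ p) ^ (1 / p)
      ≤ (s : ℝ) ^ (1 / p - 1 / 2) * √(∑ i ∈ Finset.range s, v i ^ 2) := by
  have hs0 : (0 : ℝ) < s := by exact_mod_cast hs
  have hP : 0 ≤ ∑ i ∈ Finset.range s, v i ^ p :=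
    Finset.sum_nonneg fun i _ => Real.rpow_nonneg (hv0 i) p
  have h1 := Real.rpow_sum_le_const_mul_sum_rpow_of_nonneg (Finset.range s)
    (f := fun i => v i ^ p) (p := 2 / p) (by rw [le_div_iff₀ hp]; linarith)
    (fun i _ => Real.rpow_nonneg (hv0 i) p)
  have h2 : ∀ i, (v i ^ p) ^ (2 / p) = v i ^ 2 := fun i => by
    rw [← Real.rpow_mul (hv0 i), mul_div_cancel₀ _ hp.ne', Real.rpow_two]
  simp only [h2, Finset.card_range] at h1
  have h3 := Real.rpow_le_rpow (by positivity) h1 (show (0 : ℝ) ≤ 1 / 2 by norm_num)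
  rw [← Real.rpow_mul hP, Real.mul_rpow (by positivity) (Finset.sum_nonneg fun i _ => sq_nonneg _),
    ← Real.rpow_mul hs0.le, ← Real.sqrt_eq_rpow] at h3
  convert h3 using 2
  · field_simp
  · congr 1
    field_simp

theorem sqrt_sum_sq_le (K : ℕ) {x : ℕ → ℝ} (hx : ∀ k, 0 ≤ x k) :
    √(∑ k ∈ Finset.range K, x k) ≤ ∑ k ∈ Finset.range K, √(x k) := by
  induction K with
  | zero => simp
  | succ K ih =>
    rw [Finset.sum_range_succ, Finset.sum_range_succ]
    refine (Real.sqrt_le_iff.2 ⟨by positivity, ?_⟩ : _ ≤ √(∑ k ∈ Finset.range K, x k) + √(x K)).trans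
      (by gcongr)
    rw [add_sq, Real.sq_sqrt (Finset.sum_nonneg fun k _ => hx k), Real.sq_sqrt (hx K)]
    have : 0 ≤ √(∑ k ∈ Finset.range K, x k) * √(x K) := by positivity
    linarith

end Blocks

section Recovery

/-- The contraction factor of the stable null space property with ratio `γ` and `r = s / t`; the
hypothesis on `γ` says precisely that it is less than one. -/
noncomputable def contraction (p γ r : ℝ) : ℝ := (1 + √2) / 4 * (γ - 1) * r ^ (1 / p - 1 / 2)

/-- The constant in front of the approximation error in the `ℓ_p` estimate. -/
noncomputable def errorConst (p γ r : ℝ) : ℝ := (8 / (1 - contraction p γ r ^ p)) ^ (1 / p)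

theorem contraction_lt_one {p γ : ℝ} {s t : ℕ} (hs : 1 ≤ s) (ht : 1 ≤ t)
    (h : γ - 1 < 4 * (√2 - 1) * ((t : ℝ) / s) ^ (1 / p - 1 / 2)) :
    contraction p γ ((s : ℝ) / t) < 1 := by
  have hs0 : (0 : ℝ) < s := by exact_mod_cast hs
  have ht0 : (0 : ℝ) < t := by exact_mod_cast ht
  have h2 : √2 * √2 = 2 := Real.mul_self_sqrt (by norm_num)
  have hr : ((t : ℝ) / s) ^ (1 / p - 1 / 2) * ((s : ℝ) / t) ^ (1 / p - 1 / 2) = 1 := by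
    rw [← Real.mul_rpow (by positivity) (by positivity), div_mul_div_cancel₀ hs0.ne',
      div_self ht0.ne', Real.one_rpow]
  have hpos : 0 < (1 + √2) / 4 * ((s : ℝ) / t) ^ (1 / p - 1 / 2) := by positivity
  have := mul_lt_mul_of_pos_right h hpos
  unfold contraction
  linear_combination this + (√2 - 1) * (1 + √2) * hr + h2

/-- The null space property with factor `μ < 1` and the cone condition bound the whole `ℓ_p` norm:
`P` and `Q` are the `p`-th powers of the norms on the leading `s` indices and on the rest. -/
theorem rpow_add_le_of_contraction {p : ℝ} (hp : 0 < p) (hp1 : p ≤ 1) {P Q μ e ρ : ℝ} (hP : 0 ≤ P)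
    (hQ : 0 ≤ Q) (hμ0 : 0 ≤ μ) (hμ1 : μ < 1) (he : 0 ≤ e) (hρ : 0 ≤ ρ)
    (h1 : P ^ (1 / p) ≤ μ * Q ^ (1 / p) + e) (h2 : Q ≤ P + 2 * ρ ^ p) :
    (P + Q) ^ (1 / p) ≤ (8 / (1 - μ ^ p)) ^ (1 / p) * (ρ + e) := by
  have hμp : μ ^ p < 1 := Real.rpow_lt_one hμ0 hμ1 hp
  have hμp0 : 0 ≤ μ ^ p := Real.rpow_nonneg hμ0 p
  have hinv : ∀ z : ℝ, 0 ≤ z → (z ^ (1 / p)) ^ p = z := fun z hz => by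
    rw [← Real.rpow_mul hz, one_div_mul_cancel hp.ne', Real.rpow_one]
  have h3 : P ≤ μ ^ p * Q + e ^ p := by
    have := Real.rpow_le_rpow (Real.rpow_nonneg hP _) h1 hp.le
    rw [hinv P hP] at this
    refine this.trans ((Real.rpow_add_le_add_rpow (by positivity) he hp.le hp1).trans_eq ?_)
    rw [Real.mul_rpow hμ0 (by positivity), hinv Q hQ]
  have hep : e ^ p ≤ (ρ + e) ^ p := Real.rpow_le_rpow he (by linarith) hp.le
  have hrp : ρ ^ p ≤ (ρ + e) ^ p := Real.rpow_le_rpow hρ (by linarith) hp.le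
  have hd : 0 < 1 - μ ^ p := by linarith
  have h4 : P + Q ≤ 8 / (1 - μ ^ p) * (ρ + e) ^ p := by
    rw [div_mul_eq_mul_div, le_div_iff₀ hd]
    have h5 : Q * (1 - μ ^ p) ≤ 3 * (ρ + e) ^ p := by linarith
    have h6 : P * (1 - μ ^ p) ≤ μ ^ p * (3 * (ρ + e) ^ p) + (1 - μ ^ p) * e ^ p := by
      nlinarith [mul_le_mul_of_nonneg_left h3 hd.le, mul_le_mul_of_nonneg_left h5 hμp0]
    have h7 : 0 ≤ (ρ + e) ^ p := by positivity
    nlinarith [Real.rpow_nonneg he p]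
  calc (P + Q) ^ (1 / p) ≤ (8 / (1 - μ ^ p) * (ρ + e) ^ p) ^ (1 / p) := by gcongr
    _ = _ := by
      rw [Real.mul_rpow (by positivity) (by positivity), ← Real.rpow_mul (by positivity),
        mul_one_div_cancel hp.ne', Real.rpow_one]

variable {F : Type*} [NormedAddCommGroup F] [InnerProductSpace ℝ F]

/-- The recovery estimates for a decreasing vector `v` (of singular values) whose blocks have
images `h k` with almost preserved norms. -/
theorem recovery_of_blocks {p : ℝ} (hp : 0 < p) (hp1 : p ≤ 1) {s t : ℕ} (hs : 1 ≤ s) (hst : s ≤ t)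
    {v : ℕ → ℝ} (hv : Antitone v) (hv0 : ∀ i, 0 ≤ v i) {h : ℕ → F} {α β γ : ℝ} (hα : 0 < α)
    (hαβ : α ≤ β) (hγdef : γ = β ^ 2 / α ^ 2)
    (hlow : ∀ j k, j ≠ k → ∀ ξ η : ℝ,
      α ^ 2 * (ξ ^ 2 * ∑ i ∈ block s t j, v i ^ 2 + η ^ 2 * ∑ i ∈ block s t k, v i ^ 2)
        ≤ ‖ξ • h j + η • h k‖ ^ 2)
    (hup : ∀ j k, j ≠ k → ∀ ξ η : ℝ, ‖ξ • h j + η • h k‖ ^ 2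
      ≤ β ^ 2 * (ξ ^ 2 * ∑ i ∈ block s t j, v i ^ 2 + η ^ 2 * ∑ i ∈ block s t k, v i ^ 2))
    (hγ : γ - 1 < 4 * (√2 - 1) * ((t : ℝ) / s) ^ (1 / p - 1 / 2)) {θ ρ : ℝ} (hθ : 0 ≤ θ)
    (hρ : 0 ≤ ρ) (K : ℕ) (hw : ‖∑ k ∈ Finset.range (K + 2), h k‖ ≤ 2 * β * θ)
    (htail : ∑ i ∈ Finset.Ico s (s + (K + 1) * t), v i ^ p
      ≤ ∑ i ∈ Finset.range s, v i ^ p + 2 * ρ ^ p) :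
    (∑ i ∈ Finset.range (s + (K + 1) * t), v i ^ p) ^ (1 / p)
        ≤ errorConst p γ ((s : ℝ) / t) * ρ
          + errorConst p γ ((s : ℝ) / t) * ((1 + √2) * γ) * (s : ℝ) ^ (1 / p - 1 / 2) * θ ∧
      √(∑ i ∈ Finset.range (s + (K + 1) * t), v i ^ 2)
        ≤ ((1 + √2) / 2 * (γ - 1) + 1) * errorConst p γ ((s : ℝ) / t)
            * (ρ / (t : ℝ) ^ (1 / p - 1 / 2))
          + (((1 + √2) / 2 * (γ - 1) + 1) * errorConst p γ ((s : ℝ) / t) * ((1 + √2) * γ)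
              * ((s : ℝ) / t) ^ (1 / p - 1 / 2) + 2 * ((1 + √2) * γ)) * θ := by
  have ht : 1 ≤ t := hs.trans hst
  have hs0 : (0 : ℝ) < s := by exact_mod_cast hs
  have ht0 : (0 : ℝ) < t := by exact_mod_cast ht
  have hγ1 : 1 ≤ γ := by
    rw [hγdef, one_le_div (by positivity)]
    gcongr
  set q := 1 / p - 1 / 2 with hq
  have hsq : 0 < (s : ℝ) ^ q := by positivity
  have htq : 0 < (t : ℝ) ^ q := by positivity
  have hr : ((s : ℝ) / t) ^ q = (s : ℝ) ^ q / (t : ℝ) ^ q := Real.div_rpow hs0.le ht0.le q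
  set P := ∑ i ∈ Finset.range s, v i ^ p with hPdef
  set Q := ∑ i ∈ Finset.Ico s (s + (K + 1) * t), v i ^ p with hQdef
  have hvp : ∀ i, 0 ≤ v i ^ p := fun i => Real.rpow_nonneg (hv0 i) p
  have hP : 0 ≤ P := Finset.sum_nonneg fun i _ => hvp i
  have hQ : 0 ≤ Q := Finset.sum_nonneg fun i _ => hvp i
  have hPQ : ∑ i ∈ Finset.range (s + (K + 1) * t), v i ^ p = P + Q :=
    (Finset.sum_range_add_sum_Ico _ (by simp)).symm
  let c : ℕ → ℝ := fun k => √(∑ i ∈ block s t k, v i ^ 2)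
  have hc : ∀ k, 0 ≤ c k := fun k => Real.sqrt_nonneg _
  have hcsq : ∀ k, c k ^ 2 = ∑ i ∈ block s t k, v i ^ 2 := fun k =>
    Real.sq_sqrt (Finset.sum_nonneg fun i _ => sq_nonneg _)
  obtain ⟨b0, b1⟩ := block_norm_le (c := c) hα hαβ hc (by simpa only [hcsq] using hlow)
    (by simpa only [hcsq] using hup) K rfl
  rw [← hγdef] at b0 b1
  set T := Q ^ (1 / p) with hT
  have hT0 : 0 ≤ T := Real.rpow_nonneg hQ _
  have hS : ∑ k ∈ Finset.range K, c (k + 2) ≤ ((t : ℝ) ^ q)⁻¹ * T := by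
    refine (sum_sqrt_sum_block_le hp hp1 ht hv hv0 K).trans ?_
    refine mul_le_mul_of_nonneg_left (Real.rpow_le_rpow (Finset.sum_nonneg fun i _ => hvp i) ?_
      (by positivity)) (by positivity)
    refine Finset.sum_le_sum_of_subset_of_nonneg (Finset.Ico_subset_Ico_right ?_)
      fun i _ _ => hvp i
    gcongr; simp
  have hg : (γ - 1) / 2 * ∑ k ∈ Finset.range K, c (k + 2)
      + β / α ^ 2 * ‖∑ k ∈ Finset.range (K + 2), h k‖
      ≤ (γ - 1) / 2 * (((t : ℝ) ^ q)⁻¹ * T) + 2 * γ * θ := by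
    have e1 : β / α ^ 2 * (2 * β * θ) = 2 * γ * θ := by rw [hγdef]; ring
    rw [← e1]
    have : 0 ≤ γ - 1 := by linarith
    have : 0 ≤ β / α ^ 2 := div_nonneg (hα.le.trans hαβ) (sq_nonneg _)
    gcongr
  set G := (γ - 1) / 2 * (((t : ℝ) ^ q)⁻¹ * T) + 2 * γ * θ with hG
  have c0 : c 0 ≤ (1 + √2) / 2 * G := b0.trans (by gcongr)
  have c1 : c 1 ≤ (1 + √2) / 2 * G := b1.trans (by gcongr)
  have hμ0 : 0 ≤ contraction p γ ((s : ℝ) / t) := by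
    have : 0 ≤ γ - 1 := by linarith
    unfold contraction
    positivity
  have hμ1 := contraction_lt_one hs ht hγ
  have hPle : P ^ (1 / p)
      ≤ contraction p γ ((s : ℝ) / t) * T + (1 + √2) * γ * (s : ℝ) ^ q * θ := by
    refine (sum_range_rpow_le hp hp1 hs hv0).trans ?_
    refine (mul_le_mul_of_nonneg_left c0 hsq.le).trans_eq ?_
    rw [contraction, ← hq, hr, hG]
    field_simp
    ring
  have hLp := rpow_add_le_of_contraction hp hp1 hP hQ hμ0 hμ1 (by positivity) hρ hPle htail
  rw [← errorConst] at hLp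
  have hTle : T ≤ errorConst p γ ((s : ℝ) / t) * (ρ + (1 + √2) * γ * (s : ℝ) ^ q * θ) := by
    refine le_trans ?_ hLp
    exact Real.rpow_le_rpow hQ (by linarith) (by positivity)
  refine ⟨?_, ?_⟩
  · rw [hPQ]
    exact hLp.trans_eq (by ring)
  · have e1 : √(∑ i ∈ Finset.range (s + (K + 1) * t), v i ^ 2)
        ≤ ∑ k ∈ Finset.range (K + 2), c k := by
      rw [← sum_block]
      exact sqrt_sum_sq_le _ fun k => Finset.sum_nonneg fun i _ => sq_nonneg _
    rw [Finset.sum_range_succ', Finset.sum_range_succ'] at e1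
    have e2 : √(∑ i ∈ Finset.range (s + (K + 1) * t), v i ^ 2)
        ≤ ((1 + √2) / 2 * (γ - 1) + 1) * (((t : ℝ) ^ q)⁻¹ * T) + 2 * ((1 + √2) * γ) * θ := by
      rw [hG] at c0 c1
      linarith
    refine e2.trans ?_
    have e3 : 0 ≤ (1 + √2) / 2 * (γ - 1) + 1 := by
      have : 0 ≤ γ - 1 := by linarith
      positivity
    have e4 := mul_le_mul_of_nonneg_left hTle (mul_nonneg e3 (inv_nonneg.2 htq.le))
    rw [hr]
    refine (add_le_add_left ((mul_assoc _ _ _).symm.trans_le e4) _).trans_eq ?_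
    field_simp
    ring

end Recovery

end LowRank

/-! ### Schatten norms and restricted isometry constants -/

namespace LowRank

open Module InnerProductSpace
open scoped RealInnerProductSpace

section Schatten

variable {N : ℕ}

theorem sum_singularValues_sq {E ι : Type*} [NormedAddCommGroup E] [InnerProductSpace ℝ E]
    [FiniteDimensional ℝ E] [Fintype ι] {n : ℕ} (hn : finrank ℝ E = n) (T : E →ₗ[ℝ] E)
    (b : OrthonormalBasis ι ℝ E) : ∑ i : Fin n, T.singularValues i ^ 2 = ∑ i, ‖T (b i)‖ ^ 2 := by
  simp only [T.sq_singularValues_fin hn]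
  have := T.isSymmetric_adjoint_comp_self.trace_eq_sum_eigenvalues hn
  rw [LinearMap.trace_eq_sum_inner _ b] at this
  simp only [LinearMap.comp_apply, LinearMap.adjoint_inner_right, real_inner_self_eq_norm_sq]
    at this
  exact this.symm

theorem schattenNorm_nonneg (p : ℝ) (X : Matrix (Fin N) (Fin N) ℝ) : 0 ≤ schattenNorm p X :=
  Real.rpow_nonneg (Finset.sum_nonneg fun _ _ =>
    Real.rpow_nonneg (LinearMap.singularValues_nonneg _ _) _) _

theorem schattenNorm_rpow {p : ℝ} (hp : 0 < p) (X : Matrix (Fin N) (Fin N) ℝ) :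
    schattenNorm p X ^ p = ∑ i : Fin N, (Matrix.toEuclideanLin X).singularValues (i : ℕ) ^ p := by
  rw [schattenNorm, ← Real.rpow_mul, one_div_mul_cancel hp.ne', Real.rpow_one]
  exact Finset.sum_nonneg fun _ _ => Real.rpow_nonneg (LinearMap.singularValues_nonneg _ _) _

/-- The Schatten `2`-norm is the Frobenius norm, computed in any orthonormal basis. -/
theorem schattenNorm_two_sq {ι : Type*} [Fintype ι] (X : Matrix (Fin N) (Fin N) ℝ)
    (b : OrthonormalBasis ι ℝ (EuclideanSpace ℝ (Fin N))) :
    schattenNorm 2 X ^ 2 = ∑ i, ‖Matrix.toEuclideanLin X (b i)‖ ^ 2 := by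
  have := schattenNorm_rpow two_pos X
  simp only [Real.rpow_two] at this
  rw [this, sum_singularValues_sq finrank_euclideanSpace_fin _ b]

theorem abs_entry_le_schattenNorm_two (X : Matrix (Fin N) (Fin N) ℝ) (i j : Fin N) :
    |X i j| ≤ schattenNorm 2 X := by
  refine abs_le_of_sq_le_sq ?_ (schattenNorm_nonneg 2 X)
  rw [schattenNorm_two_sq X (EuclideanSpace.basisFun (Fin N) ℝ)]
  calc X i j ^ 2 ≤ ‖Matrix.toEuclideanLin X (EuclideanSpace.basisFun (Fin N) ℝ j)‖ ^ 2 := by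
        rw [EuclideanSpace.real_norm_sq_eq]
        refine le_trans (le_of_eq ?_) (Finset.single_le_sum (fun k _ => sq_nonneg _)
          (Finset.mem_univ i))
        simp [Matrix.toLpLin_apply]
    _ ≤ _ := Finset.single_le_sum
      (f := fun j => ‖Matrix.toEuclideanLin X (EuclideanSpace.basisFun (Fin N) ℝ j)‖ ^ 2)
      (fun k _ => sq_nonneg _) (Finset.mem_univ j)

theorem finrank_range_toEuclideanLin (X : Matrix (Fin N) (Fin N) ℝ) :
    finrank ℝ (LinearMap.range (Matrix.toEuclideanLin X)) = X.rank := by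
  rw [Matrix.rank_eq_finrank_range_toLin X (PiLp.basisFun 2 ℝ _) (PiLp.basisFun 2 ℝ _),
    ← Matrix.toLpLin_eq_toLin]

/-- The matrix with singular vectors `u i`, `v i` and (signed) singular values `d i`. -/
noncomputable def ofSVD (u v : OrthonormalBasis (Fin N) ℝ (EuclideanSpace ℝ (Fin N))) :
    (Fin N → ℝ) →ₗ[ℝ] Matrix (Fin N) (Fin N) ℝ where
  toFun d := Matrix.toEuclideanLin.symm (v.toBasis.constr ℝ fun i => d i • u i)
  map_add' d d' := by
    rw [← map_add, ← map_add]
    congr 2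
    exact funext fun i => add_smul _ _ _
  map_smul' a d := by
    rw [RingHom.id_apply, ← map_smul, ← map_smul]
    congr 2
    exact funext fun i => mul_smul _ _ _

variable (u v : OrthonormalBasis (Fin N) ℝ (EuclideanSpace ℝ (Fin N)))

theorem toEuclideanLin_ofSVD_apply (d : Fin N → ℝ) (i : Fin N) :
    Matrix.toEuclideanLin (ofSVD u v d) (v i) = d i • u i := by
  have h : Matrix.toEuclideanLin (ofSVD u v d) = v.toBasis.constr ℝ fun i => d i • u i :=
    LinearEquiv.apply_symm_apply _ _
  rw [h, ← v.coe_toBasis, Basis.constr_basis]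

theorem schattenNorm_two_ofSVD_sq (d : Fin N → ℝ) :
    schattenNorm 2 (ofSVD u v d) ^ 2 = ∑ i, d i ^ 2 := by
  rw [schattenNorm_two_sq _ v]
  refine Finset.sum_congr rfl fun i _ => ?_
  rw [toEuclideanLin_ofSVD_apply, norm_smul, u.norm_eq_one, mul_one, Real.norm_eq_abs, sq_abs]

theorem rank_ofSVD_le {d : Fin N → ℝ} {J : Finset (Fin N)} (h : ∀ i, i ∉ J → d i = 0) :
    (ofSVD u v d).rank ≤ J.card := by
  classical
  rw [← finrank_range_toEuclideanLin]
  have hle : LinearMap.range (Matrix.toEuclideanLin (ofSVD u v d))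
      ≤ Submodule.span ℝ (J.image u : Set (EuclideanSpace ℝ (Fin N))) := by
    rw [LinearMap.range_eq_map, ← v.toBasis.span_eq, Submodule.map_span, Submodule.span_le]
    rintro _ ⟨_, ⟨i, rfl⟩, rfl⟩
    rw [v.coe_toBasis, toEuclideanLin_ofSVD_apply]
    by_cases hi : i ∈ J
    · exact Submodule.smul_mem _ _ (Submodule.subset_span (by simpa using ⟨i, hi, rfl⟩))
    · simp [h i hi]
  exact (Submodule.finrank_mono hle).trans
    ((finrank_span_finset_le_card _).trans Finset.card_image_le)

theorem exists_ofSVD_eq (X : Matrix (Fin N) (Fin N) ℝ) :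
    ∃ u v, ofSVD u v (fun i => (Matrix.toEuclideanLin X).singularValues (i : ℕ)) = X := by
  obtain ⟨u, v, h⟩ := exists_svd finrank_euclideanSpace_fin (Matrix.toEuclideanLin X)
  refine ⟨u, v, Matrix.toEuclideanLin.injective (v.toBasis.ext fun i => ?_)⟩
  rw [v.coe_toBasis, toEuclideanLin_ofSVD_apply, h]

end Schatten

section RIP

variable {N m : ℕ} (A : Matrix (Fin N) (Fin N) ℝ →ₗ[ℝ] EuclideanSpace ℝ (Fin m))

/-- The supremum defining `lowerRIP` is attained. -/
theorem lowerRIP_mul_le {k : ℕ} {Z : Matrix (Fin N) (Fin N) ℝ} (hZ : Z.rank ≤ k) :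
    lowerRIP A k * schattenNorm 2 Z ≤ ‖A Z‖ := by
  rcases (schattenNorm_nonneg 2 Z).eq_or_lt with h | h
  · simp [← h]
  · rw [← le_div_iff₀ h]
    exact csSup_le ⟨0, le_rfl, fun Z _ => by simp⟩ fun a ha => (le_div_iff₀ h).2 (ha.2 Z hZ)

theorem exists_norm_le_mul_schattenNorm_two :
    ∃ b, 0 ≤ b ∧ ∀ Z, ‖A Z‖ ≤ b * schattenNorm 2 Z := by
  refine ⟨∑ i, ∑ j, ‖A (Matrix.single i j 1)‖, by positivity, fun Z => ?_⟩
  conv_lhs => rw [Matrix.matrix_eq_sum_single Z]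
  simp only [map_sum, Finset.sum_mul]
  refine norm_sum_le_of_le _ fun i _ => norm_sum_le_of_le _ fun j _ => ?_
  have : Matrix.single i j (Z i j) = Z i j • Matrix.single i j (1 : ℝ) := by simp
  rw [this, map_smul, norm_smul, mul_comm]
  gcongr
  exact abs_entry_le_schattenNorm_two Z i j

/-- The infimum defining `upperRIP` is attained; the set of upper constants is nonempty because
`A` is bounded. -/
theorem norm_le_upperRIP_mul {k : ℕ} {Z : Matrix (Fin N) (Fin N) ℝ} (hZ : Z.rank ≤ k) :
    ‖A Z‖ ≤ upperRIP A k * schattenNorm 2 Z := by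
  obtain ⟨b, hb, h⟩ := exists_norm_le_mul_schattenNorm_two A
  rcases (schattenNorm_nonneg 2 Z).eq_or_lt with h0 | h0
  · simpa [← h0] using h Z
  · rw [← div_le_iff₀ h0]
    exact le_csInf ⟨b, hb, fun Z _ => h Z⟩ fun a ha => (div_le_iff₀ h0).2 (ha.2 Z hZ)

theorem upperRIP_mono {k l : ℕ} (hkl : k ≤ l) : upperRIP A k ≤ upperRIP A l := by
  obtain ⟨b, hb, h⟩ := exists_norm_le_mul_schattenNorm_two A
  exact csInf_le_csInf ⟨0, fun a ha => ha.1⟩ ⟨b, hb, fun Z _ => h Z⟩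
    fun a ha => ⟨ha.1, fun Z hZ => ha.2 Z (hZ.trans hkl)⟩

/-- In dimension zero every real number is an admissible lower constant, so that `lowerRIP` takes
the value `sSup (Set.Ici 0) = 0`; otherwise a matrix of rank one compares the two constants. -/
theorem lowerRIP_le_upperRIP {k : ℕ} (hk : 1 ≤ k) (h : 0 < lowerRIP A k) :
    lowerRIP A k ≤ upperRIP A k := by
  rcases Nat.eq_zero_or_pos N with rfl | hN
  · exfalso
    have hnb : ¬ BddAbove {a : ℝ | 0 ≤ a ∧ ∀ Z : Matrix (Fin 0) (Fin 0) ℝ, Z.rank ≤ k →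
        a * schattenNorm 2 Z ≤ ‖A Z‖} := by
      rintro ⟨B, hB⟩
      have := hB (a := |B| + 1) ⟨by positivity, fun Z _ => by simp [schattenNorm]⟩
      linarith [le_abs_self B]
    rw [lowerRIP, Real.sSup_of_not_bddAbove hnb] at h
    exact lt_irrefl _ h
  · let b := EuclideanSpace.basisFun (Fin N) ℝ
    let i₀ : Fin N := ⟨0, hN⟩
    let Z := ofSVD b b (Pi.single i₀ 1)
    have hr : Z.rank ≤ k := (rank_ofSVD_le b b (J := {i₀}) fun i hi => by
      simp at hi; simp [hi]).trans (by simpa using hk)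
    have hZ : schattenNorm 2 Z ^ 2 = 1 := by
      rw [schattenNorm_two_ofSVD_sq]
      simp [Pi.single_apply]
    have hZ1 : schattenNorm 2 Z = 1 := by
      rwa [pow_eq_one_iff_of_nonneg (schattenNorm_nonneg 2 Z) two_ne_zero] at hZ
    have := (lowerRIP_mul_le A hr).trans (norm_le_upperRIP_mul A hr)
    rwa [hZ1, mul_one, mul_one] at this

end RIP

section Mirsky

variable {N : ℕ}

/-- The concave Mirsky inequality for `x ↦ x ^ p`. -/
theorem sum_abs_singularValues_rpow_sub_le {p : ℝ} (hp : 0 < p) (hp1 : p ≤ 1)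
    (X Y : Matrix (Fin N) (Fin N) ℝ) :
    ∑ i : Fin N, |(Matrix.toEuclideanLin X).singularValues (i : ℕ) ^ p
      - (Matrix.toEuclideanLin Y).singularValues (i : ℕ) ^ p| ≤ schattenNorm p (X - Y) ^ p := by
  rw [schattenNorm_rpow hp, map_sub]
  exact sum_abs_concave_singularValues_sub_le finrank_euclideanSpace_fin _ _
    (Real.concaveOn_rpow hp.le hp1)
    (fun a ha b _ hab => Real.rpow_le_rpow ha hab hp.le) (Real.zero_rpow hp.ne')

theorem rankError_nonneg (p : ℝ) (s : ℕ) (X : Matrix (Fin N) (Fin N) ℝ) : 0 ≤ rankError p s X :=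
  Real.sInf_nonneg (by rintro _ ⟨Y, -, rfl⟩; exact schattenNorm_nonneg p _)

/-- The tail of the singular values of `X` is at most its distance to the matrices of rank `s`. -/
theorem sum_tail_le_rankError {p : ℝ} (hp : 0 < p) (hp1 : p ≤ 1) (s : ℕ)
    (X : Matrix (Fin N) (Fin N) ℝ) :
    ∑ i : Fin N, (if (i : ℕ) < s then 0 else (Matrix.toEuclideanLin X).singularValues (i : ℕ) ^ p)
      ≤ rankError p s X ^ p := by
  set S := ∑ i : Fin N,
    (if (i : ℕ) < s then 0 else (Matrix.toEuclideanLin X).singularValues (i : ℕ) ^ p)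
  have hS : 0 ≤ S := Finset.sum_nonneg fun i _ => by
    split_ifs
    · exact le_rfl
    · exact Real.rpow_nonneg (LinearMap.singularValues_nonneg _ _) _
  have h1 : S ^ (1 / p) ≤ rankError p s X := by
    refine le_csInf ⟨_, 0, by simp, rfl⟩ ?_
    rintro _ ⟨Y, hY, rfl⟩
    rw [← Real.rpow_le_rpow_iff (by positivity) (schattenNorm_nonneg p _) hp, ← Real.rpow_mul hS,
      one_div_mul_cancel hp.ne', Real.rpow_one]
    refine le_trans (Finset.sum_le_sum fun i _ => ?_)
      (sum_abs_singularValues_rpow_sub_le hp hp1 X Y)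
    split_ifs with hi
    · exact abs_nonneg _
    · have : (Matrix.toEuclideanLin Y).singularValues (i : ℕ) = 0 := by
        rw [LinearMap.singularValues_eq_zero_iff_le_finrank_range, finrank_range_toEuclideanLin]
        omega
      rw [this, Real.zero_rpow hp.ne', sub_zero]
      exact le_abs_self _
  have := Real.rpow_le_rpow (by positivity) h1 hp.le
  rwa [← Real.rpow_mul hS, one_div_mul_cancel hp.ne', Real.rpow_one] at this

/-- The cone condition on the error `X - W` of a minimizer `W`: the concave Mirsky inequality is
applied to `X` and `X - W`, whose difference is `W`. -/
theorem sum_tail_error_le {p : ℝ} (hp : 0 < p) (hp1 : p ≤ 1) (s : ℕ)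
    {X W : Matrix (Fin N) (Fin N) ℝ} (h : schattenNorm p W ≤ schattenNorm p X) :
    ∑ i : Fin N, (if (i : ℕ) < s then 0
        else (Matrix.toEuclideanLin (X - W)).singularValues (i : ℕ) ^ p)
      ≤ ∑ i : Fin N, (if (i : ℕ) < s
          then (Matrix.toEuclideanLin (X - W)).singularValues (i : ℕ) ^ p else 0)
        + 2 * rankError p s X ^ p := by
  have h1 := sum_abs_singularValues_rpow_sub_le hp hp1 X (X - W)
  rw [sub_sub_cancel] at h1
  have h2 := h1.trans (Real.rpow_le_rpow (schattenNorm_nonneg p W) h hp.le)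
  rw [schattenNorm_rpow hp X] at h2
  have h3 := sum_tail_le_rankError hp hp1 s X
  have h4 : ∑ i : Fin N, ((if (i : ℕ) < s then 0
        else (Matrix.toEuclideanLin (X - W)).singularValues (i : ℕ) ^ p)
      + (Matrix.toEuclideanLin X).singularValues (i : ℕ) ^ p)
      ≤ ∑ i : Fin N, ((|(Matrix.toEuclideanLin X).singularValues (i : ℕ) ^ p
      - (Matrix.toEuclideanLin (X - W)).singularValues (i : ℕ) ^ p| + (if (i : ℕ) < s
          then (Matrix.toEuclideanLin (X - W)).singularValues (i : ℕ) ^ p else 0)) + 2 *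
        (if (i : ℕ) < s then 0 else (Matrix.toEuclideanLin X).singularValues (i : ℕ) ^ p)) := by
    refine Finset.sum_le_sum fun i _ => ?_
    split_ifs
    · linarith [le_abs_self ((Matrix.toEuclideanLin X).singularValues (i : ℕ) ^ p
        - (Matrix.toEuclideanLin (X - W)).singularValues (i : ℕ) ^ p)]
    · linarith [neg_abs_le ((Matrix.toEuclideanLin X).singularValues (i : ℕ) ^ p
        - (Matrix.toEuclideanLin (X - W)).singularValues (i : ℕ) ^ p)]
  rw [Finset.sum_add_distrib, Finset.sum_add_distrib, Finset.sum_add_distrib,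
    ← Finset.mul_sum] at h4
  linarith

end Mirsky

end LowRank

/-! ### Recovery of matrices -/

namespace LowRank

open Module InnerProductSpace
open scoped RealInnerProductSpace

section Assembly

theorem sum_fin_ite_mem {N : ℕ} {g : ℕ → ℝ} (hg : ∀ i, N ≤ i → g i = 0) (J : Finset ℕ) :
    ∑ i : Fin N, (if (i : ℕ) ∈ J then g i else 0) = ∑ i ∈ J, g i := by
  rw [Fin.sum_univ_eq_sum_range (fun i => if i ∈ J then g i else 0), Finset.sum_ite_mem]
  refine Finset.sum_subset Finset.inter_subset_right fun i hi hi' => hg i ?_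
  by_contra h
  exact hi' (Finset.mem_inter.2 ⟨Finset.mem_range.2 (by omega), hi⟩)

theorem sum_fin_eq_sum_range {N M : ℕ} (hNM : N ≤ M) {g : ℕ → ℝ} (hg : ∀ i, N ≤ i → g i = 0) :
    ∑ i : Fin N, g i = ∑ i ∈ Finset.range M, g i := by
  rw [← sum_fin_ite_mem hg]
  exact Finset.sum_congr rfl fun i _ => by rw [if_pos (Finset.mem_range.2 (i.2.trans_le hNM))]

/-- The vector `σ` restricted to the `k`-th block of indices. -/
noncomputable def blockPart (N s t : ℕ) (σ : ℕ → ℝ) (k : ℕ) : Fin N → ℝ :=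
  fun i => if (i : ℕ) ∈ block s t k then σ i else 0

theorem sum_blockPart {N s t : ℕ} (ht : 1 ≤ t) (σ : ℕ → ℝ) :
    ∑ k ∈ Finset.range (N + 2), blockPart N s t σ k = fun i : Fin N => σ i := by
  ext i
  have h := sum_block s t (N + 1) fun j => if j = (i : ℕ) then σ i else 0
  simp only [Finset.sum_ite_eq'] at h
  rw [Finset.sum_apply]
  refine h.trans (if_pos (Finset.mem_range.2 ?_))
  nlinarith [i.2]

theorem sum_combination_blockPart_sq {N s t : ℕ} {σ : ℕ → ℝ} (hσ : ∀ i, N ≤ i → σ i = 0)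
    {j k : ℕ} (hjk : j ≠ k) (ξ η : ℝ) :
    ∑ i, (ξ • blockPart N s t σ j + η • blockPart N s t σ k) i ^ 2
      = ξ ^ 2 * ∑ i ∈ block s t j, σ i ^ 2 + η ^ 2 * ∑ i ∈ block s t k, σ i ^ 2 := by
  have h0 : ∀ i, N ≤ i → σ i ^ 2 = 0 := fun i hi => by rw [hσ i hi]; simp
  rw [← sum_fin_ite_mem h0, ← sum_fin_ite_mem h0, Finset.mul_sum, Finset.mul_sum,
    ← Finset.sum_add_distrib]
  refine Finset.sum_congr rfl fun i _ => ?_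
  simp only [Pi.add_apply, Pi.smul_apply, smul_eq_mul, blockPart]
  by_cases hj : (i : ℕ) ∈ block s t j
  · have hk : (i : ℕ) ∉ block s t k := Finset.disjoint_left.1 (block_disjoint hjk) hj
    simp [hj, hk, mul_pow]
  · by_cases hk : (i : ℕ) ∈ block s t k <;> simp [hj, hk, mul_pow]

theorem rank_ofSVD_combination_blockPart_le {N s t : ℕ} (hst : s ≤ t) (σ : ℕ → ℝ)
    (u v : OrthonormalBasis (Fin N) ℝ (EuclideanSpace ℝ (Fin N))) (j k : ℕ) (ξ η : ℝ) :
    (ofSVD u v (ξ • blockPart N s t σ j + η • blockPart N s t σ k)).rank ≤ 2 * t := by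
  let J : Finset (Fin N) := {i | (i : ℕ) ∈ block s t j ∪ block s t k}
  refine (rank_ofSVD_le u v (J := J) fun i hi => ?_).trans ?_
  · have hi' : (i : ℕ) ∉ block s t j ∪ block s t k := by simpa [J] using hi
    rw [Finset.mem_union, not_or] at hi'
    simp [blockPart, hi'.1, hi'.2]
  · have h1 : J.card ≤ (block s t j ∪ block s t k).card :=
      Finset.card_le_card_of_injOn (fun i => (i : ℕ)) (fun i hi => by simpa [J] using hi)
        (Fin.val_injective.injOn)
    have h2 := Finset.card_union_le (block s t j) (block s t k)
    have h3 := card_block_le hst j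
    have h4 := card_block_le hst k
    omega

end Assembly

end LowRank

theorem mainTheorem3 :
    -- the constants are functions of `p`, `γ_{2t}` and `s / t` only
    ∃ C₁ C₂ D₁ D₂ : ℝ → ℝ → ℝ → ℝ,
      ∀ (p : ℝ), 0 < p → p ≤ 1 →
      ∀ (N m s t : ℕ), 1 ≤ s → s ≤ t →
      ∀ (A : Matrix (Fin N) (Fin N) ℝ →ₗ[ℝ] EuclideanSpace ℝ (Fin m)),
        -- `γ_{2t}` is well defined (finite)
        0 < LowRank.lowerRIP A (2 * t) →
        LowRank.ratioRIP A (2 * t) - 1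
          < 4 * (Real.sqrt 2 - 1) * ((t : ℝ) / (s : ℝ)) ^ (1 / p - 1 / 2) →
      ∀ (θ : ℝ), 0 ≤ θ →
      ∀ (X : Matrix (Fin N) (Fin N) ℝ) (y : EuclideanSpace ℝ (Fin m)),
        ‖A X - y‖ ≤ LowRank.upperRIP A (2 * s) * θ →
      ∀ (Xstar : Matrix (Fin N) (Fin N) ℝ),
        LowRank.IsSchattenMinimizer p A y (LowRank.upperRIP A (2 * s) * θ) Xstar →
        LowRank.schattenNorm p (X - Xstar)
            ≤ C₁ p (LowRank.ratioRIP A (2 * t)) ((s : ℝ) / (t : ℝ)) * LowRank.rankError p s X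
              + D₁ p (LowRank.ratioRIP A (2 * t)) ((s : ℝ) / (t : ℝ))
                * (s : ℝ) ^ (1 / p - 1 / 2) * θ ∧
        LowRank.schattenNorm 2 (X - Xstar)
            ≤ C₂ p (LowRank.ratioRIP A (2 * t)) ((s : ℝ) / (t : ℝ))
                * (LowRank.rankError p s X / (t : ℝ) ^ (1 / p - 1 / 2))
              + D₂ p (LowRank.ratioRIP A (2 * t)) ((s : ℝ) / (t : ℝ)) * θ := by
  refine ⟨fun p γ r => LowRank.errorConst p γ r,
    fun p γ r => ((1 + √2) / 2 * (γ - 1) + 1) * LowRank.errorConst p γ r,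
    fun p γ r => LowRank.errorConst p γ r * ((1 + √2) * γ),
    fun p γ r => ((1 + √2) / 2 * (γ - 1) + 1) * LowRank.errorConst p γ r * ((1 + √2) * γ)
      * r ^ (1 / p - 1 / 2) + 2 * ((1 + √2) * γ), ?_⟩
  intro p hp hp1 N m s t hs hst A hα hγ θ hθ X y hy W hW
  have ht : 1 ≤ t := hs.trans hst
  have hαβ := LowRank.lowerRIP_le_upperRIP A (show 1 ≤ 2 * t by omega) hα
  obtain ⟨u, v, huv⟩ := LowRank.exists_ofSVD_eq (X - W)
  set T := Matrix.toEuclideanLin (X - W) with hT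
  let σ : ℕ → ℝ := T.singularValues
  have hσ0 : ∀ i, N ≤ i → σ i = 0 := fun i hi =>
    T.singularValues_of_finrank_le (by rwa [finrank_euclideanSpace_fin])
  have hσp : ∀ i, N ≤ i → σ i ^ p = 0 := fun i hi => by rw [hσ0 i hi, Real.zero_rpow hp.ne']
  have hσ2 : ∀ i, N ≤ i → σ i ^ (2 : ℝ) = 0 := fun i hi => by simp [hσ0 i hi]
  -- Sums over `Fin N` become sums over an initial segment of `ℕ` long enough to consist of
  -- complete blocks; the added singular values vanish.
  have hM : N ≤ s + (N + 1) * t := by nlinarith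
  let h : ℕ → EuclideanSpace ℝ (Fin m) := fun k =>
    A (LowRank.ofSVD u v (LowRank.blockPart N s t σ k))
  have hcomb : ∀ (j k : ℕ) (ξ η : ℝ), ξ • h j + η • h k = A (LowRank.ofSVD u v
      (ξ • LowRank.blockPart N s t σ j + η • LowRank.blockPart N s t σ k)) := fun j k ξ η => by
    simp only [h, map_add, map_smul]
  have hsum : ∑ k ∈ Finset.range (N + 2), h k = A (X - W) := by
    simp only [h]
    rw [← map_sum, ← map_sum, LowRank.sum_blockPart ht]
    exact congrArg A huv
  -- Both `X` and the minimizer are feasible; monotonicity of `upperRIP` passes from `2s` to `2t`.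
  have hw : ‖∑ k ∈ Finset.range (N + 2), h k‖ ≤ 2 * LowRank.upperRIP A (2 * t) * θ := by
    have e1 : A (X - W) = (A X - y) - (A W - y) := by rw [map_sub]; abel
    have e2 : LowRank.upperRIP A (2 * s) * θ ≤ LowRank.upperRIP A (2 * t) * θ :=
      mul_le_mul_of_nonneg_right (LowRank.upperRIP_mono A (by omega)) hθ
    rw [hsum, e1]
    linarith [norm_sub_le (A X - y) (A W - y), hW.1]
  have htail := LowRank.sum_tail_error_le hp hp1 s (hW.2 X hy)
  have htail' : ∑ i ∈ Finset.Ico s (s + (N + 1) * t), σ i ^ p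
      ≤ ∑ i ∈ Finset.range s, σ i ^ p + 2 * LowRank.rankError p s X ^ p := by
    rw [← LowRank.sum_fin_ite_mem hσp, ← LowRank.sum_fin_ite_mem hσp]
    simp only [Finset.mem_range]
    refine le_of_eq_of_le (Finset.sum_congr rfl fun i _ => ?_) htail
    have hi : (i : ℕ) < s + (N + 1) * t := i.2.trans_le hM
    simp only [Finset.mem_Ico, hi, and_true]
    by_cases his : (i : ℕ) < s
    · rw [if_neg (by omega), if_pos his]
    · rw [if_pos (by omega), if_neg his]
  have key := LowRank.recovery_of_blocks (v := σ) (h := h)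
    (γ := LowRank.ratioRIP A (2 * t)) hp hp1 hs hst T.singularValues_antitone
    T.singularValues_nonneg hα hαβ rfl
    (fun j k hjk ξ η => by
      rw [hcomb, ← LowRank.sum_combination_blockPart_sq hσ0 hjk,
        ← LowRank.schattenNorm_two_ofSVD_sq u v, ← mul_pow]
      exact pow_le_pow_left₀ (mul_nonneg hα.le (LowRank.schattenNorm_nonneg 2 _))
        (LowRank.lowerRIP_mul_le A
          (LowRank.rank_ofSVD_combination_blockPart_le hst σ u v j k ξ η)) 2)
    (fun j k hjk ξ η => by
      rw [hcomb, ← LowRank.sum_combination_blockPart_sq hσ0 hjk,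
        ← LowRank.schattenNorm_two_ofSVD_sq u v, ← mul_pow]
      exact pow_le_pow_left₀ (norm_nonneg _)
        (LowRank.norm_le_upperRIP_mul A
          (LowRank.rank_ofSVD_combination_blockPart_le hst σ u v j k ξ η)) 2)
    hγ hθ (LowRank.rankError_nonneg p s X) N hw htail'
  have hn : ∀ q : ℝ, (∀ i, N ≤ i → σ i ^ q = 0) → LowRank.schattenNorm q (X - W)
      = (∑ i ∈ Finset.range (s + (N + 1) * t), σ i ^ q) ^ (1 / q) := fun q hq => by
    rw [← LowRank.sum_fin_eq_sum_range hM hq, LowRank.schattenNorm]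
  rw [hn p hσp, hn 2 hσ2, ← Real.sqrt_eq_rpow]
  simpa only [Real.rpow_two] using key
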